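/- Let $\mathbb B$ be the commutative associative algebra over $\mathbb C$ with basis $\{e_1,e_2\}$, where $e_1=1$ is the unit and $e_2^2=e_1+2ie_2$, equipped with the norm $\|z_1e_1+z_2e_2\|=\sqrt{|z_1|^2+|z_2|^2}$ ($z_1,z_2\in\mathbb C$). Let $\mu=\{\zeta=xe_1+ye_2: x,y\in\mathbb R\}$, let $D_\zeta=\{\zeta\in\mu:\|\zeta\|<1\}$ be the open unit disk of $\mu$ and $\partial D_\zeta=\{\zeta\in\mu:\|\zeta\|=1\}$; let $\partial D_z=\{t\in\mathbb C:|t|=1\}$. For $a=U_1e_1+U_2\,ie_1+U_3e_2+U_4\,ie_2\in\mathbb B$ with real $U_l$ write $U_l[a]=U_l$. A function $\Phi:D_\zeta\to\mathbb B$ is monogenic if the limit $\lim_{h\to0,\,h\in\mu}(\Phi(\zeta+h)-\Phi(\zeta))h^{-1}$ exists in $\mathbb B$ for every $\zeta\in D_\zeta$. Given $u_1,u_4:\partial D_\zeta\to\mathbb R$, a solution of the (1-4)-problem is a continuous function $\Phi:\overline{D_\zeta}\to\mathbb B$ that is monogenic in $D_\zeta$ and satisfies $U_1[\Phi(\zeta)]=u_1(\zeta)$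 and $U_4[\Phi(\zeta)]=u_4(\zeta)$ for all $\zeta\in\partial D_\zeta$. For $u:\partial D_\zeta\to\mathbb R$ put $\omega(u,\varepsilon)=\sup\{|u(\zeta_1)-u(\zeta_2)|:\zeta_1,\zeta_2\in\partial D_\zeta,\ \|\zeta_1-\zeta_2\|\le\varepsilon\}$, put $\widehat u(x+iy)=u(xe_1+ye_2)$ for $x+iy\in\partial D_z$, and, for $\zeta\in D_\zeta$, $$S_{D_\zeta}[u](\zeta)=\frac1{2\pi i}\int_{\partial D_\zeta}u(\tau)(\tau+\zeta)(\tau-\zeta)^{-1}\tau^{-1}\,d\tau ,$$ all circles being traversed counterclockwise. Theorem. Let $u_1,u_4:\partial D_\zeta\to\mathbb R$ satisfy the Dini condition $\int_0^1\frac{\omega(u_l,\eta)}{\eta}\,d\eta<\infty$, $l\in\{1,4\}$. Then the general solution of the (1-4)-problem in the unit disk is given, for $\zeta\in D_\zeta$, by $$\Phi(\zeta)=S_{D_\zeta}[u_1](\zeta)\,e_1+S_{D_\zeta}[u_4](\zeta)\,ie_2+\bigl((b_1+ib_2)\zeta+b\bigr)(e_1+ie_2)+a_1\,ie_1+a_2\,e_2,$$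 where $a_1,a_2$ are arbitrary real constants and $$b_1=-\frac1{2\pi}\operatorname{Im}\int_{\partial D_z}\frac{\widehat u_1(t)-\widehat u_4(t)}{t^2}\,dt,\quad b_2=-\frac1{2\pi}\operatorname{Re}\int_{\partial D_z}\frac{\widehat u_1(t)-\widehat u_4(t)}{t^2}\,dt,\quad b=-\frac1{2\pi}\operatorname{Im}\int_{\partial D_z}\frac{\widehat u_1(t)-\widehat u_4(t)}{t^3}\,dt .$$ That is: for all real $a_1,a_2$ this function on $D_\zeta$ extends to a solution $\Phi:\overline{D_\zeta}\to\mathbb B$ of the (1-4)-problem; and a function $\Phi:\overline{D_\zeta}\to\mathbb B$ is a solution if and only if it is continuous and coincides on $D_\zeta$ with this formula for some real $a_1,a_2$. -/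

import Mathlib

open Filter Topology
open Complex (I)
open scoped ENNReal Real

noncomputable section

/-- The biharmonic algebra `𝔹`: the commutative algebra over `ℂ` with basis `e₁ = 1`, `e₂`
and multiplication `e₂ ^ 2 = e₁ + 2 i e₂`. An element is `z₁ e₁ + z₂ e₂`, stored as `⟨z₁, z₂⟩`. -/
def Biharm : Type := QuadraticAlgebra ℂ 1 (2 * I)

namespace Biharm

instance : CommRing Biharm := inferInstanceAs (CommRing (QuadraticAlgebra ℂ 1 (2 * I)))

instance : Algebra ℂ Biharm := inferInstanceAs (Algebra ℂ (QuadraticAlgebra ℂ 1 (2 * I)))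

/-- The element `z₁ e₁ + z₂ e₂`. -/
def ofCoeffs (z₁ z₂ : ℂ) : Biharm := QuadraticAlgebra.mk z₁ z₂

/-- The coefficient of `e₁`. -/
def coeff₁ (a : Biharm) : ℂ := QuadraticAlgebra.re a

/-- The coefficient of `e₂`. -/
def coeff₂ (a : Biharm) : ℂ := QuadraticAlgebra.im a

/-- The basis element `e₁`, the unit of the algebra. -/
def e₁ : Biharm := 1

/-- The basis element `e₂`. -/
def e₂ : Biharm := ofCoeffs 0 1

@[simp] theorem coeff₁_ofCoeffs (z w : ℂ) : (ofCoeffs z w).coeff₁ = z := rfl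

@[simp] theorem coeff₂_ofCoeffs (z w : ℂ) : (ofCoeffs z w).coeff₂ = w := rfl

theorem ofCoeffs_eq (z w : ℂ) : ofCoeffs z w = z • e₁ + w • e₂ := by
  apply QuadraticAlgebra.ext
  · change z = z * 1 + w * 0
    ring
  · change w = z * 0 + w * 1
    ring

theorem eq_ofCoeffs (a : Biharm) : a = ofCoeffs a.coeff₁ a.coeff₂ := rfl

theorem e₂_sq : e₂ ^ 2 = e₁ + (2 * I) • e₂ := by
  rw [pow_two]
  apply QuadraticAlgebra.ext
  · change (0 : ℂ) * 0 + 1 * 1 * 1 = 1 + 2 * I * 0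
    ring
  · change (0 : ℂ) * 1 + 1 * 0 + 2 * I * 1 * 1 = 0 + 2 * I * 1
    ring

/-- The coordinate map onto `ℂ × ℂ` with its Euclidean norm. -/
def toL2 : Biharm →ₗ[ℂ] WithLp 2 (ℂ × ℂ) where
  toFun a := WithLp.toLp 2 (a.coeff₁, a.coeff₂)
  map_add' _ _ := rfl
  map_smul' _ _ := rfl

theorem toL2_injective : Function.Injective toL2 := by
  intro a b h
  have h' := congrArg WithLp.ofLp h
  exact QuadraticAlgebra.ext (congrArg Prod.fst h') (congrArg Prod.snd h')

/-- The Euclidean norm on the algebra (see `norm_eq`). -/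
instance : NormedAddCommGroup Biharm :=
  NormedAddCommGroup.induced Biharm (WithLp 2 (ℂ × ℂ)) toL2 toL2_injective

instance : NormedSpace ℂ Biharm := NormedSpace.induced ℂ Biharm (WithLp 2 (ℂ × ℂ)) toL2

theorem norm_eq (a : Biharm) : ‖a‖ = √(‖a.coeff₁‖ ^ 2 + ‖a.coeff₂‖ ^ 2) :=
  WithLp.prod_norm_eq_of_L2 (toL2 a)

/-- The biharmonic plane `μ = {x e₁ + y e₂ : x, y ∈ ℝ}`, with the norm of the algebra. -/
def plane : Submodule ℝ Biharm := Submodule.span ℝ {e₁, e₂}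

/-- The point `ζ = x e₁ + y e₂` of the biharmonic plane. -/
def pt (x y : ℝ) : plane :=
  ⟨x • e₁ + y • e₂, add_mem
    (Submodule.smul_mem _ _ (Submodule.subset_span (Set.mem_insert _ _)))
    (Submodule.smul_mem _ _ (Submodule.subset_span (Set.mem_insert_of_mem _ rfl)))⟩

/-! Real components in `a = U₁ e₁ + U₂ i e₁ + U₃ e₂ + U₄ i e₂`. -/

/-- The component of `e₁`. -/
def U₁ (a : Biharm) : ℝ := a.coeff₁.re

/-- The component of `i e₂`. -/
def U₄ (a : Biharm) : ℝ := a.coeff₂.im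

/-- `Φ` has at `ζ` the classical derivative
`lim (Φ (ζ + h) - Φ ζ) h⁻¹` as `h → 0` in the biharmonic plane (`h ≠ 0`, all of which are
invertible in the algebra), for every `ζ ∈ D`. -/
def MonogenicOn (Φ : plane → Biharm) (D : Set plane) : Prop :=
  ∀ ζ ∈ D, ∃ Φ' : Biharm,
    Tendsto (fun h : plane => (Φ (ζ + h) - Φ ζ) * Ring.inverse (h : Biharm)) (𝓝[≠] 0) (𝓝 Φ')

/-- `Φ` is a solution of the (1-4)-problem in `D` with boundary data `u₁`, `u₄`. -/
structure IsSolution14 (D : Set plane) (u₁ u₄ : plane → ℝ) (Φ : plane → Biharm) : Prop where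
  continuousOn : ContinuousOn Φ (closure D)
  monogenicOn : MonogenicOn Φ D
  boundary₁ : ∀ ζ ∈ frontier D, U₁ (Φ ζ) = u₁ ζ
  boundary₄ : ∀ ζ ∈ frontier D, U₄ (Φ ζ) = u₄ ζ

/-- The open unit disk of the biharmonic plane. -/
def disk : Set plane := Metric.ball 0 1

/-- The unit circle of the biharmonic plane. -/
def circle : Set plane := Metric.sphere 0 1

/-- The modulus of continuity on the unit circle, with values in `[0, ∞]`. -/
def modulus (u : plane → ℝ) (ε : ℝ) : ℝ≥0∞ :=
  ⨆ (ζ₁ ∈ circle) (ζ₂ ∈ circle) (_ : ‖ζ₁ - ζ₂‖ ≤ ε), ENNReal.ofReal |u ζ₁ - u ζ₂|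

/-- The Dini condition on the unit circle. -/
def DiniCondition (u : plane → ℝ) : Prop :=
  ∫⁻ η in Set.Ioc (0 : ℝ) 1, modulus u η / ENNReal.ofReal η < ∞

/-- The function on the complex plane corresponding to `u` under `x e₁ + y e₂ ↔ x + i y`. -/
def hat (u : plane → ℝ) (z : ℂ) : ℝ := u (pt z.re z.im)

/-- The integral of `f` with respect to `dτ` along the unit circle of the biharmonic plane,
counterclockwise: `τ = cos θ e₁ + sin θ e₂`, `dτ = (-sin θ e₁ + cos θ e₂) dθ`. -/
def contourIntegral (f : plane → Biharm) : Biharm :=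
  ∫ θ in (0 : ℝ)..2 * π, f (pt (Real.cos θ) (Real.sin θ)) * (pt (-Real.sin θ) (Real.cos θ) : Biharm)

/-- The biharmonic Schwarz-type integral
`(1 / (2 π i)) ∫ u(τ) (τ + ζ) (τ - ζ)⁻¹ τ⁻¹ dτ` over the unit circle. -/
def schwarz (u : plane → ℝ) (ζ : plane) : Biharm :=
  (1 / (2 * π * I) : ℂ) • contourIntegral fun τ =>
    u τ • (((τ : Biharm) + ζ) * Ring.inverse ((τ : Biharm) - ζ) * Ring.inverse (τ : Biharm))

/-- The moment `∫ (û₁(t) - û₄(t)) / t ^ k dt` over the unit circle of `ℂ`. -/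
def moment (u₁ u₄ : plane → ℝ) (k : ℕ) : ℂ :=
  ∮ t in C(0, 1), ((hat u₁ t - hat u₄ t : ℝ) : ℂ) / t ^ k

/-- The constant `b₁`. -/
def b₁ (u₁ u₄ : plane → ℝ) : ℝ := -(1 / (2 * π)) * (moment u₁ u₄ 2).im

/-- The constant `b₂`. -/
def b₂ (u₁ u₄ : plane → ℝ) : ℝ := -(1 / (2 * π)) * (moment u₁ u₄ 2).re

/-- The constant `b`. -/
def b₀ (u₁ u₄ : plane → ℝ) : ℝ := -(1 / (2 * π)) * (moment u₁ u₄ 3).im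

/-- The explicit solution in the open unit disk with parameters `a₁`, `a₂`. -/
def generalSolution (u₁ u₄ : plane → ℝ) (a₁ a₂ : ℝ) (ζ : plane) : Biharm :=
  schwarz u₁ ζ * e₁ + schwarz u₄ ζ * (I • e₂)
    + (((b₁ u₁ u₄ : ℂ) + b₂ u₁ u₄ * I) • (ζ : Biharm) + (b₀ u₁ u₄ : ℂ) • e₁) * (e₁ + I • e₂)
    + a₁ • (I • e₁) + a₂ • e₂

end Biharm

end

/-! The element `ρ = e₁ + i e₂` satisfies `ρ ^ 2 = 0`, so `𝔹` is the algebra of dual numbers over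
`ℂ`: every element is `p + q ρ`, and the point `x e₁ + y e₂` is `z - i y ρ` with `z = x + i y`. A
function with components `F` and `-i y F' + G`, where `F` and `G` are holomorphic, is monogenic.
Since `U₁ = Re p + Re q` and `U₄ = Re q`, the problem prescribes `Re p = u₁ - u₄` and `Re q = u₄` on
the circle.

Existence. The scalar part of the biharmonic Schwarz integral of `u` is the classical Schwarz
integral `S`; its nilpotent part is `-(1 - |z|²) / (2 z) * S'(z) + c₁ / z + c₂`, where `c_k` is the
mean of `u(t) t⁻ᵏ` (`parts_schwarz`, `schwarzNil_eq`). Under the Dini condition `S` has limits on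
the circle, with real part `u` (`exists_tendsto_schwarzCircle`). By Cauchy's estimate `(1 - |z|)
S'(z)` then tends to `0`, so the nilpotent part tends to `c₁ / t + c₂` (`tendsto_nilPart_schwarz`).
The constants `b₁`, `b₂`, `b` cancel the real part of this error for the difference of the data.

Uniqueness. For zero data the scalar part is holomorphic with vanishing boundary real part, hence an
imaginary constant. This makes the nilpotent part holomorphic, and the same argument applies to it
(`IsSolution14.exists_eq_const`). The two free constants are `a₁` and `a₂`. -/

noncomputable section

/-! ### Cauchy-type integrals over the unit circle. -/

/-- The integral `∫ g(θ) (t - z)⁻ⁿ dθ` over the unit circle, `t = exp (i θ)`. -/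
def cauchyPow (g : ℝ → ℂ) (n : ℕ) (z : ℂ) : ℂ :=
  ∫ θ in (0 : ℝ)..2 * π, g θ * ((Circle.exp θ - z)⁻¹) ^ n

theorem circle_exp_sub_ne_zero (θ : ℝ) {z : ℂ} (hz : ‖z‖ < 1) : (Circle.exp θ : ℂ) - z ≠ 0 := by
  intro h
  rw [sub_eq_zero] at h
  rw [← h, Circle.norm_coe] at hz
  exact lt_irrefl _ hz

theorem continuous_cauchyPow_integrand {g : ℝ → ℂ} (hg : Continuous g) (n : ℕ) {z : ℂ}
    (hz : ‖z‖ < 1) : Continuous fun θ : ℝ => g θ * (((Circle.exp θ : ℂ) - z)⁻¹) ^ n := by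
  refine hg.mul (Continuous.pow (Continuous.inv₀ (by fun_prop) fun θ => ?_) n)
  exact circle_exp_sub_ne_zero θ hz

theorem hasDerivAt_cauchyPow {g : ℝ → ℂ} (hg : Continuous g) (n : ℕ) {z : ℂ} (hz : ‖z‖ < 1) :
    HasDerivAt (cauchyPow g n) (n * cauchyPow g (n + 1) z) z := by
  -- Half the distance to the circle: for `w` within `δ` of `z`, every point of the circle stays at
  -- distance at least `δ` from `w`, which gives the uniform majorant of the derivative.
  set δ := (1 - ‖z‖) / 2 with hδ
  have hδ0 : 0 < δ := by rw [hδ]; linarith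
  have hball : ∀ w ∈ Metric.ball z δ, ‖w‖ < 1 := fun w hw => by
    rw [mem_ball_iff_norm] at hw
    have := norm_sub_norm_le w z
    linarith
  have hlow : ∀ w ∈ Metric.ball z δ, ∀ θ : ℝ, δ ≤ ‖(Circle.exp θ : ℂ) - w‖ := fun w hw θ => by
    rw [mem_ball_iff_norm] at hw
    have h1 := norm_sub_norm_le w z
    have h2 := norm_sub_norm_le (Circle.exp θ : ℂ) w
    rw [Circle.norm_coe] at h2
    linarith
  have key := intervalIntegral.hasDerivAt_integral_of_dominated_loc_of_deriv_le
    (μ := MeasureTheory.volume) (a := 0) (b := 2 * π) (x₀ := z)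
    (F := fun w θ => g θ * (((Circle.exp θ : ℂ) - w)⁻¹) ^ n)
    (F' := fun w θ => (n : ℂ) * (g θ * (((Circle.exp θ : ℂ) - w)⁻¹) ^ (n + 1)))
    (bound := fun θ => n * (‖g θ‖ * (δ⁻¹) ^ (n + 1)))
    (Metric.ball_mem_nhds z hδ0) ?_ ?_ ?_ ?_ ?_ ?_
  · have := key.2
    rw [intervalIntegral.integral_const_mul] at this
    exact this
  · filter_upwards [Metric.ball_mem_nhds z hδ0] with w hw
    exact (continuous_cauchyPow_integrand hg n (hball w hw)).aestronglyMeasurable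
  · exact (continuous_cauchyPow_integrand hg n hz).intervalIntegrable _ _
  · exact (continuous_const.mul (continuous_cauchyPow_integrand hg (n + 1) hz)).aestronglyMeasurable
  · refine Eventually.of_forall fun θ _ w hw => ?_
    rw [norm_mul, norm_mul, norm_pow, norm_inv, Complex.norm_natCast]
    have := hlow w hw θ
    gcongr
  · exact (Continuous.intervalIntegrable (by fun_prop) _ _)
  · refine Eventually.of_forall fun θ _ w hw => ?_
    have hne := circle_exp_sub_ne_zero θ (hball w hw)
    have h1 : HasDerivAt (fun w : ℂ => (Circle.exp θ : ℂ) - w) (-1) w := by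
      simpa using (hasDerivAt_id w).const_sub (Circle.exp θ : ℂ)
    have h2 := ((h1.inv hne).pow n).const_mul (g θ)
    refine HasDerivAt.congr_deriv h2 ?_
    simp only [Pi.inv_apply]
    rcases n with _ | n
    · simp
    · rw [Nat.add_sub_cancel, neg_neg, one_div, ← inv_pow]
      ring

/-! ### The kernel `(t + z) / (t - z)` and integrals over the circle. -/

/-- The chord is `2 |sin (θ / 2)|`; the bound is Jordan's inequality. -/
theorem norm_circle_exp_sub_one_ge {θ : ℝ} (h : |θ| ≤ π) :
    2 / π * |θ| ≤ ‖(Circle.exp θ : ℂ) - 1‖ := by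
  rw [Circle.coe_exp, mul_comm (θ : ℂ), Complex.norm_exp_I_mul_ofReal_sub_one, norm_mul,
    Real.norm_eq_abs, Real.norm_eq_abs, abs_two]
  have h1 : |Real.sin (θ / 2)| = Real.sin (|θ| / 2) := by
    rcases abs_cases θ with ⟨h2, h3⟩ | ⟨h2, h3⟩
    · rw [h2, abs_of_nonneg]
      exact Real.sin_nonneg_of_nonneg_of_le_pi (by linarith) (by linarith)
    · rw [h2, neg_div, Real.sin_neg, abs_of_nonpos]
      exact Real.sin_nonpos_of_nonpos_of_neg_pi_le (by linarith) (by linarith)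
  rw [h1]
  have := Real.mul_le_sin (x := |θ| / 2) (by positivity) (by linarith)
  linarith

theorem norm_circle_exp_sub_one_le (θ : ℝ) : ‖(Circle.exp θ : ℂ) - 1‖ ≤ |θ| := by
  rw [Circle.coe_exp, mul_comm (θ : ℂ)]
  exact Real.norm_exp_I_mul_ofReal_sub_one_le

/-- Since `1 - r ≤ |t - r|`, the triangle inequality gives `|t - 1| ≤ 2 |t - r|`, and the chord
bound applies. Uniformity in `r` is what dominated convergence needs. -/
theorem norm_herglotz_le {θ r : ℝ} (h : |θ| ≤ π) (hθ : θ ≠ 0) (hr0 : 0 ≤ r) (hr : r ≤ 1) :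
    ‖((Circle.exp θ : ℂ) + r) / ((Circle.exp θ : ℂ) - r)‖ ≤ 2 * π / |θ| := by
  have h1 : ‖(Circle.exp θ : ℂ) + r‖ ≤ 2 := by
    refine (norm_add_le _ _).trans ?_
    rw [Circle.norm_coe, Complex.norm_real, Real.norm_eq_abs, abs_of_nonneg hr0]
    linarith
  have h2 : ‖(1 : ℂ) - r‖ ≤ ‖(Circle.exp θ : ℂ) - r‖ := by
    have e1 : ‖(1 : ℂ) - r‖ = 1 - r := by
      rw [← Complex.ofReal_one, ← Complex.ofReal_sub, Complex.norm_real, Real.norm_eq_abs,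
        abs_of_nonneg (by linarith)]
    have h3 := norm_sub_norm_le (Circle.exp θ : ℂ) r
    rw [Circle.norm_coe, Complex.norm_real, Real.norm_eq_abs, abs_of_nonneg hr0] at h3
    linarith
  have h4 : ‖(Circle.exp θ : ℂ) - 1‖ ≤ 2 * ‖(Circle.exp θ : ℂ) - r‖ := by
    have := norm_sub_le ((Circle.exp θ : ℂ) - r) (1 - r)
    rw [sub_sub_sub_cancel_right] at this
    linarith
  have h5 := norm_circle_exp_sub_one_ge h
  have hθ' : 0 < |θ| := abs_pos.2 hθ
  have hπ := Real.pi_pos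
  have h6 : |θ| / π ≤ ‖(Circle.exp θ : ℂ) - r‖ := by
    have : 2 / π * |θ| = 2 * (|θ| / π) := by ring
    linarith
  rw [norm_div]
  calc _ ≤ 2 / (|θ| / π) := by gcongr
    _ = _ := by field_simp

/-- On the circle conjugation is inversion, and it changes the sign of the quotient. Hence the
limiting kernel contributes nothing to the real part of the boundary value. -/
theorem herglotz_one_eq (t : Circle) :
    ((t : ℂ) + 1) / (t - 1) = (((t : ℂ) + 1) / (t - 1)).im * I := by
  have hconj : (starRingEnd ℂ) (((t : ℂ) + 1) / (t - 1)) = -(((t : ℂ) + 1) / (t - 1)) := by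
    rw [map_div₀, map_add, map_sub, map_one, ← Circle.coe_inv_eq_conj, Circle.coe_inv]
    -- At `t = 1` the quotient is `0` by the convention for division by zero.
    by_cases h : (t : ℂ) = 1
    · simp [h]
    have h1 : (t : ℂ) - 1 ≠ 0 := sub_ne_zero.2 h
    have h2 : 1 - (t : ℂ) ≠ 0 := sub_ne_zero.2 (Ne.symm h)
    have h3 : (t : ℂ) ≠ 0 := t.coe_ne_zero
    have h4 : (t : ℂ)⁻¹ - 1 ≠ 0 := by
      intro h5
      rw [sub_eq_zero, inv_eq_one] at h5
      exact h h5
    field_simp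
    ring
  have hre : (((t : ℂ) + 1) / (t - 1)).re = 0 := by
    have := congrArg Complex.re hconj
    rw [Complex.conj_re, Complex.neg_re] at this
    linarith
  conv_lhs => rw [← Complex.re_add_im (((t : ℂ) + 1) / (t - 1)), hre]
  simp

theorem integral_circle_shift (f : Circle → ℂ) (s : Circle) :
    ∫ θ in (0 : ℝ)..2 * π, f (Circle.exp θ) = ∫ θ in (-π)..π, f (s * Circle.exp θ) := by
  obtain ⟨α, rfl⟩ := Circle.exp_surjective s
  have hper : Function.Periodic (fun θ : ℝ => f (Circle.exp θ)) (2 * π) := fun θ => by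
    simp only [Circle.exp_add_two_pi]
  simp_rw [← Circle.exp_add]
  rw [intervalIntegral.integral_comp_add_left (fun θ => f (Circle.exp θ)) α]
  have := hper.intervalIntegral_add_eq 0 (α + -π)
  rw [zero_add] at this
  rw [this]
  congr 1
  ring

theorem integral_inv_circle_exp_sub {z : ℂ} (hz : ‖z‖ < 1) :
    ∫ θ in (0 : ℝ)..2 * π, (Circle.exp θ : ℂ) * ((Circle.exp θ : ℂ) - z)⁻¹ = 2 * π := by
  have h := circleIntegral.integral_sub_inv_of_mem_ball (c := 0) (w := z) (R := 1) (by simpa using hz)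
  rw [circleIntegral] at h
  have e : ∀ θ : ℝ, deriv (circleMap 0 1) θ • (circleMap 0 1 θ - z)⁻¹ =
      I * ((Circle.exp θ : ℂ) * ((Circle.exp θ : ℂ) - z)⁻¹) := fun θ => by
    rw [deriv_circleMap, circleMap, Circle.coe_exp, smul_eq_mul]
    simp
    ring
  simp_rw [e] at h
  rw [intervalIntegral.integral_const_mul] at h
  have : I * (∫ θ in (0 : ℝ)..2 * π, (Circle.exp θ : ℂ) * ((Circle.exp θ : ℂ) - z)⁻¹)
      = I * (2 * π) := by rw [h]; ring
  exact mul_left_cancel₀ Complex.I_ne_zero this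

/-! ### The Schwarz integral, its derivative and the companion holomorphic function. -/

/-- The Schwarz integral `(1 / 2π) ∫ v(t) (t + z) / (t - z) dθ`, `t = exp (i θ)`,
written as a Cauchy integral. -/
def schwarzCircle (v : Circle → ℝ) (z : ℂ) : ℂ :=
  (π : ℂ)⁻¹ * cauchyPow (fun θ => v (Circle.exp θ) * Circle.exp θ) 1 z
    - (2 * π : ℂ)⁻¹ * ∫ θ in (0 : ℝ)..2 * π, (v (Circle.exp θ) : ℂ)

/-- The derivative of `schwarzCircle`. -/
def schwarzCircleDeriv (v : Circle → ℝ) (z : ℂ) : ℂ :=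
  (π : ℂ)⁻¹ * cauchyPow (fun θ => v (Circle.exp θ) * Circle.exp θ) 2 z

/-- The mean of `v(t) t⁻ᵏ` over the unit circle. -/
def circleCoeff (v : Circle → ℝ) (k : ℕ) : ℂ :=
  (2 * π : ℂ)⁻¹ * ∫ θ in (0 : ℝ)..2 * π, (v (Circle.exp θ) : ℂ) * ((Circle.exp θ : ℂ)⁻¹) ^ k

/-- The holomorphic part of the nilpotent component of the Schwarz integral in the
biharmonic plane. -/
def schwarzNil (v : Circle → ℝ) (z : ℂ) : ℂ :=
  (2 * π : ℂ)⁻¹ * (z * cauchyPow (fun θ => v (Circle.exp θ) * Circle.exp θ) 2 z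
    - cauchyPow (fun θ => v (Circle.exp θ) * (Circle.exp θ : ℂ)⁻¹) 1 z
    - cauchyPow (fun θ => v (Circle.exp θ)) 2 z) + circleCoeff v 2

section

variable {v : Circle → ℝ}

theorem continuous_circle_data (hv : Continuous v) :
    Continuous fun θ : ℝ => (v (Circle.exp θ) : ℂ) := by fun_prop

theorem continuous_circle_data_mul (hv : Continuous v) :
    Continuous fun θ : ℝ => (v (Circle.exp θ) : ℂ) * Circle.exp θ := by fun_prop

theorem continuous_circle_data_mul_inv (hv : Continuous v) :
    Continuous fun θ : ℝ => (v (Circle.exp θ) : ℂ) * (Circle.exp θ : ℂ)⁻¹ :=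
  (continuous_circle_data hv).mul
    (Continuous.inv₀ (by fun_prop) fun θ => (Circle.exp θ).coe_ne_zero)

theorem hasDerivAt_schwarzCircle (hv : Continuous v) {z : ℂ} (hz : ‖z‖ < 1) :
    HasDerivAt (schwarzCircle v) (schwarzCircleDeriv v z) z := by
  have h := ((hasDerivAt_cauchyPow (continuous_circle_data_mul hv) 1 hz).const_mul
    (π : ℂ)⁻¹).sub_const ((2 * π : ℂ)⁻¹ * ∫ θ in (0 : ℝ)..2 * π, (v (Circle.exp θ) : ℂ))
  rw [Nat.cast_one, one_mul] at h
  exact h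

theorem differentiableAt_schwarzCircleDeriv (hv : Continuous v) {z : ℂ} (hz : ‖z‖ < 1) :
    DifferentiableAt ℂ (schwarzCircleDeriv v) z :=
  ((hasDerivAt_cauchyPow (continuous_circle_data_mul hv) 2 hz).const_mul _).differentiableAt

theorem differentiableAt_schwarzNil (hv : Continuous v) {z : ℂ} (hz : ‖z‖ < 1) :
    DifferentiableAt ℂ (schwarzNil v) z := by
  have h1 := (hasDerivAt_cauchyPow (continuous_circle_data_mul hv) 2 hz).differentiableAt
  have h2 := (hasDerivAt_cauchyPow (continuous_circle_data_mul_inv hv) 1 hz).differentiableAt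
  have h3 := (hasDerivAt_cauchyPow (continuous_circle_data hv) 2 hz).differentiableAt
  exact ((((differentiableAt_id.mul h1).sub h2).sub h3).const_mul _).add_const _

theorem schwarzCircleDeriv_zero : schwarzCircleDeriv v 0 = 2 * circleCoeff v 1 := by
  have hπ : (π : ℂ) ≠ 0 := Complex.ofReal_ne_zero.2 Real.pi_ne_zero
  have h : ∀ θ : ℝ, (v (Circle.exp θ) : ℂ) * Circle.exp θ * (((Circle.exp θ : ℂ) - 0)⁻¹) ^ 2
      = (v (Circle.exp θ) : ℂ) * ((Circle.exp θ : ℂ)⁻¹) ^ 1 := fun θ => by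
    have := (Circle.exp θ).coe_ne_zero
    rw [sub_zero]
    field_simp
  rw [schwarzCircleDeriv, circleCoeff, cauchyPow]
  simp_rw [h]
  field_simp

/-- With `-i y = -(z - z̄) / 2`, this form merges the two terms in `S'` of the nilpotent part into
the coefficient `-(1 - |z|²) / (2 z)`, small near the circle. The definition by Cauchy integrals
avoids the apparent singularity at `0`. -/
theorem schwarzNil_eq (hv : Continuous v) {z : ℂ} (hz : ‖z‖ < 1) (hz0 : z ≠ 0) :
    schwarzNil v z = (z - z⁻¹) / 2 * schwarzCircleDeriv v z
      + z⁻¹ / 2 * schwarzCircleDeriv v 0 + circleCoeff v 2 := by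
  have hπ : (π : ℂ) ≠ 0 := Complex.ofReal_ne_zero.2 Real.pi_ne_zero
  have h0 : ‖(0 : ℂ)‖ < 1 := by simp
  -- Integrates `t⁻¹ / (t - z) + 1 / (t - z) ^ 2 = z⁻¹ * (t / (t - z) ^ 2 - t⁻¹)` against `v`.
  have key : cauchyPow (fun θ => v (Circle.exp θ) * (Circle.exp θ : ℂ)⁻¹) 1 z
      + cauchyPow (fun θ => v (Circle.exp θ)) 2 z
      = z⁻¹ * cauchyPow (fun θ => v (Circle.exp θ) * Circle.exp θ) 2 z
        - z⁻¹ * cauchyPow (fun θ => v (Circle.exp θ) * Circle.exp θ) 2 0 := by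
    unfold cauchyPow
    rw [← intervalIntegral.integral_const_mul, ← intervalIntegral.integral_const_mul,
      ← intervalIntegral.integral_add, ← intervalIntegral.integral_sub]
    · refine intervalIntegral.integral_congr fun θ _ => ?_
      have h1 := circle_exp_sub_ne_zero θ hz
      have h2 := (Circle.exp θ).coe_ne_zero
      simp only [sub_zero]
      field_simp
      ring
    · exact (continuous_const.mul (continuous_cauchyPow_integrand
        (continuous_circle_data_mul hv) 2 hz)).intervalIntegrable _ _
    · exact (continuous_const.mul (continuous_cauchyPow_integrand
        (continuous_circle_data_mul hv) 2 h0)).intervalIntegrable _ _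
    · exact (continuous_cauchyPow_integrand
        (continuous_circle_data_mul_inv hv) 1 hz).intervalIntegrable _ _
    · exact (continuous_cauchyPow_integrand
        (continuous_circle_data hv) 2 hz).intervalIntegrable _ _
  rw [schwarzNil, sub_sub, key, schwarzCircleDeriv, schwarzCircleDeriv]
  field_simp
  ring

/-- The kernel has mean `1`, so `v s` can be split off; rotation by `s` then makes the kernel depend
on `r` only. The increment of `v` compensates the singularity of the kernel as `r → 1`. -/
theorem schwarzCircle_polar (hv : Continuous v) {r : ℝ} (hr0 : 0 ≤ r) (hr : r < 1) (s : Circle) :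
    schwarzCircle v (r * s) = v s + (2 * π : ℂ)⁻¹ * ∫ θ in (-π)..π,
      ((v (s * Circle.exp θ) - v s : ℝ) : ℂ) *
        (((Circle.exp θ : ℂ) + r) / ((Circle.exp θ : ℂ) - r)) := by
  have hπ : (π : ℂ) ≠ 0 := Complex.ofReal_ne_zero.2 Real.pi_ne_zero
  have hz : ‖(r * s : ℂ)‖ < 1 := by
    rwa [norm_mul, Circle.norm_coe, mul_one, Complex.norm_real, Real.norm_eq_abs,
      abs_of_nonneg hr0]
  have hs := integral_circle_shift
    (fun c => ((v c - v s : ℝ) : ℂ) * (((c : ℂ) + r * s) / ((c : ℂ) - r * s))) s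
  have e1 : ∀ θ : ℝ, ((v (s * Circle.exp θ) - v s : ℝ) : ℂ) *
      ((((s * Circle.exp θ : Circle) : ℂ) + r * s) / (((s * Circle.exp θ : Circle) : ℂ) - r * s))
      = ((v (s * Circle.exp θ) - v s : ℝ) : ℂ) *
        (((Circle.exp θ : ℂ) + r) / ((Circle.exp θ : ℂ) - r)) := fun θ => by
    rw [Circle.coe_mul, mul_comm (r : ℂ), ← mul_add, ← mul_sub,
      mul_div_mul_left _ _ s.coe_ne_zero]
  simp_rw [e1] at hs
  rw [← hs]
  set z : ℂ := r * s with hzdef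
  have c1 := continuous_cauchyPow_integrand (continuous_circle_data_mul hv) 1 hz
  have c2 : Continuous fun θ : ℝ => (Circle.exp θ : ℂ) * ((Circle.exp θ : ℂ) - z)⁻¹ := by
    simpa using continuous_cauchyPow_integrand (g := fun θ => (Circle.exp θ : ℂ))
      (by fun_prop) 1 hz
  have e2 : ∀ θ : ℝ, ((v (Circle.exp θ) - v s : ℝ) : ℂ) *
      (((Circle.exp θ : ℂ) + z) / ((Circle.exp θ : ℂ) - z))
      = (2 * ((v (Circle.exp θ) : ℂ) * Circle.exp θ * (((Circle.exp θ : ℂ) - z)⁻¹) ^ 1)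
        - v (Circle.exp θ))
        - (2 * v s * ((Circle.exp θ : ℂ) * ((Circle.exp θ : ℂ) - z)⁻¹) - v s) := fun θ => by
    have := circle_exp_sub_ne_zero θ hz
    rw [Complex.ofReal_sub]
    generalize (Circle.exp θ : ℂ) = w at *
    field_simp
    ring
  simp_rw [e2]
  rw [intervalIntegral.integral_sub, intervalIntegral.integral_sub, intervalIntegral.integral_sub,
    intervalIntegral.integral_const_mul, intervalIntegral.integral_const_mul,
    integral_inv_circle_exp_sub hz, intervalIntegral.integral_const, schwarzCircle, cauchyPow]
  · generalize (∫ θ in (0 : ℝ)..2 * π, (v (Circle.exp θ) : ℂ)) = X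
    generalize (∫ θ in (0 : ℝ)..2 * π, (v (Circle.exp θ) : ℂ) * Circle.exp θ *
      (((Circle.exp θ : ℂ) - z)⁻¹) ^ 1) = Y
    rw [sub_zero, Complex.real_smul, Complex.ofReal_mul, Complex.ofReal_ofNat]
    field_simp
    ring
  · exact (continuous_const.mul c2).intervalIntegrable _ _
  · exact continuous_const.intervalIntegrable _ _
  · exact (continuous_const.mul c1).intervalIntegrable _ _
  · exact (continuous_circle_data hv).intervalIntegrable _ _
  · exact ((continuous_const.mul c1).sub (continuous_circle_data hv)).intervalIntegrable _ _
  · exact ((continuous_const.mul c2).sub continuous_const).intervalIntegrable _ _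

/-! ### Boundary limits of the Schwarz integral. -/

/-- A Dini-type majorant for the increments of a function on the unit circle. -/
def HasDiniBound (v : Circle → ℝ) : Prop :=
  ∃ g : ℝ → ℝ, IntervalIntegrable g MeasureTheory.volume (-π) π ∧
    ∀ (s : Circle) (θ : ℝ), |θ| ≤ π → |v (s * Circle.exp θ) - v s| ≤ |θ| * g θ

theorem circle_exp_arg_eq {z : ℂ} (hz : z ≠ 0) : (Circle.exp z.arg : ℂ) = z / ‖z‖ := by
  have h : (‖z‖ : ℂ) ≠ 0 := Complex.ofReal_ne_zero.2 (norm_ne_zero_iff.2 hz)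
  rw [eq_div_iff h, mul_comm, Circle.coe_exp, Complex.norm_mul_exp_arg_mul_I]

theorem tendsto_circle_exp_arg (t : Circle) :
    Tendsto (fun z : ℂ => Circle.exp z.arg) (𝓝 (t : ℂ)) (𝓝 t) := by
  refine Topology.IsInducing.subtypeVal.tendsto_nhds_iff.2 ?_
  have h1 : Tendsto (fun z : ℂ => z / ‖z‖) (𝓝 (t : ℂ)) (𝓝 ((t : ℂ) / ‖(t : ℂ)‖)) := by
    refine tendsto_id.div ?_ (by simp)
    exact (Complex.continuous_ofReal.comp continuous_norm).tendsto _
  rw [Circle.norm_coe, Complex.ofReal_one, div_one] at h1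
  refine h1.congr' ?_
  filter_upwards [isOpen_ne.mem_nhds t.coe_ne_zero] with z hz
  exact (circle_exp_arg_eq hz).symm

/-- Dominated convergence in the polar formula: the increment is at most `|θ| g θ` and the kernel at
most `2 π / |θ|`, so `2 π g` dominates for every approach to `t` within the disk. The limiting
integral is purely imaginary. -/
theorem exists_tendsto_schwarzCircle (hv : Continuous v) (hd : HasDiniBound v) (t : Circle) :
    ∃ l : ℂ, l.re = v t ∧ Tendsto (schwarzCircle v) (𝓝[Metric.ball 0 1] (t : ℂ)) (𝓝 l) := by
  obtain ⟨g, hg, hbound⟩ := hd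
  have hπ := Real.pi_pos
  have huIoc : ∀ θ ∈ Set.uIoc (-π) π, |θ| ≤ π := fun θ hθ => by
    rw [Set.uIoc_of_le (by linarith)] at hθ
    exact abs_le.2 ⟨hθ.1.le, hθ.2⟩
  set F : ℂ → ℝ → ℂ := fun z θ =>
    ((v (Circle.exp z.arg * Circle.exp θ) - v (Circle.exp z.arg) : ℝ) : ℂ) *
      (((Circle.exp θ : ℂ) + ‖z‖) / ((Circle.exp θ : ℂ) - ‖z‖)) with hF
  set f : ℝ → ℂ := fun θ => ((v (t * Circle.exp θ) - v t : ℝ) : ℂ) *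
      (((Circle.exp θ : ℂ) + 1) / ((Circle.exp θ : ℂ) - 1)) with hf
  have hne : ∀ᵐ θ : ℝ ∂MeasureTheory.volume, θ ≠ 0 := by
    simp [MeasureTheory.ae_iff]
  have hmem : ∀ᶠ z : ℂ in 𝓝[Metric.ball 0 1] (t : ℂ), ‖z‖ < 1 := by
    filter_upwards [self_mem_nhdsWithin] with z hz
    simpa using hz
  have harg : Tendsto (fun z : ℂ => Circle.exp z.arg) (𝓝[Metric.ball 0 1] (t : ℂ)) (𝓝 t) :=
    (tendsto_circle_exp_arg t).mono_left nhdsWithin_le_nhds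
  have hnorm : Tendsto (fun z : ℂ => (‖z‖ : ℂ)) (𝓝[Metric.ball 0 1] (t : ℂ)) (𝓝 1) := by
    have : Tendsto (fun z : ℂ => (‖z‖ : ℂ)) (𝓝 (t : ℂ)) (𝓝 ((‖(t : ℂ)‖ : ℝ) : ℂ)) :=
      (Complex.continuous_ofReal.comp continuous_norm).tendsto _
    rw [Circle.norm_coe, Complex.ofReal_one] at this
    exact this.mono_left nhdsWithin_le_nhds
  have hlim : Tendsto (fun z => ∫ θ in (-π)..π, F z θ) (𝓝[Metric.ball 0 1] (t : ℂ))
      (𝓝 (∫ θ in (-π)..π, f θ)) := by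
    refine intervalIntegral.tendsto_integral_filter_of_dominated_convergence
      (fun θ => 2 * π * g θ) ?_ ?_ (hg.const_mul _) ?_
    · filter_upwards [hmem] with z hz
      have hz' : ‖((‖z‖ : ℝ) : ℂ)‖ < 1 := by simpa using hz
      refine Continuous.aestronglyMeasurable ?_
      refine Continuous.mul (by fun_prop) (Continuous.div (by fun_prop) (by fun_prop) fun θ => ?_)
      exact circle_exp_sub_ne_zero θ hz'
    · filter_upwards [hmem] with z hz
      filter_upwards [hne] with θ hθ0 hθ
      have h1 := hbound (Circle.exp z.arg) θ (huIoc θ hθ)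
      rw [hF, norm_mul, Complex.norm_real, Real.norm_eq_abs]
      have h2 := norm_herglotz_le (huIoc θ hθ) hθ0 (norm_nonneg z) hz.le
      have h3 : 0 < |θ| := abs_pos.2 hθ0
      calc _ ≤ |θ| * g θ * (2 * π / |θ|) := by gcongr; exact (abs_nonneg _).trans h1
        _ = 2 * π * g θ := by field_simp
    · filter_upwards [hne] with θ hθ0 hθ
      have hexp : (Circle.exp θ : ℂ) - 1 ≠ 0 := by
        have h1 := norm_circle_exp_sub_one_ge (huIoc θ hθ)
        have h3 : 0 < |θ| := abs_pos.2 hθ0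
        exact norm_pos_iff.1 (lt_of_lt_of_le (by positivity) h1)
      refine Tendsto.mul ?_ ((tendsto_const_nhds.add hnorm).div
        (tendsto_const_nhds.sub hnorm) hexp)
      have h1 : Tendsto (fun z : ℂ => v (Circle.exp z.arg * Circle.exp θ))
          (𝓝[Metric.ball 0 1] (t : ℂ)) (𝓝 (v (t * Circle.exp θ))) :=
        (hv.tendsto _).comp (harg.mul_const _)
      have h2 : Tendsto (fun z : ℂ => v (Circle.exp z.arg))
          (𝓝[Metric.ball 0 1] (t : ℂ)) (𝓝 (v t)) := (hv.tendsto _).comp harg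
      exact (Complex.continuous_ofReal.tendsto _).comp (h1.sub h2)
  refine ⟨v t + (2 * π : ℂ)⁻¹ * ∫ θ in (-π)..π, f θ, ?_, ?_⟩
  · have hfI : ∀ θ, f θ = (((v (t * Circle.exp θ) - v t) *
        (((Circle.exp θ : ℂ) + 1) / ((Circle.exp θ : ℂ) - 1)).im : ℝ) : ℂ) * I := fun θ => by
      rw [hf]
      simp only
      rw [herglotz_one_eq]
      push_cast
      simp [mul_assoc]
    simp_rw [hfI]
    rw [intervalIntegral.integral_mul_const, intervalIntegral.integral_ofReal]
    have : (2 * π : ℂ)⁻¹ = (((2 * π)⁻¹ : ℝ) : ℂ) := by push_cast; ring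
    rw [this, ← mul_assoc, ← Complex.ofReal_mul]
    simp
  · have h2 : Tendsto (fun z : ℂ => (v (Circle.exp z.arg) : ℂ))
        (𝓝[Metric.ball 0 1] (t : ℂ)) (𝓝 (v t)) :=
      (Complex.continuous_ofReal.tendsto _).comp ((hv.tendsto _).comp harg)
    refine (h2.add (hlim.const_mul _)).congr' ?_
    filter_upwards [hmem] with z hz
    have := schwarzCircle_polar hv (norm_nonneg z) hz (Circle.exp z.arg)
    rw [Circle.coe_exp, Complex.norm_mul_exp_arg_mul_I] at this
    rw [this]

/-! ### Derivatives near the circle, and holomorphic functions with zero boundary real part. -/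

/-- A holomorphic function in the unit disk that has a limit at a boundary point has there a
derivative of order `o(1 / (1 - |z|))`. -/
theorem tendsto_one_sub_norm_mul_deriv {f : ℂ → ℂ} (hf : DifferentiableOn ℂ f (Metric.ball 0 1))
    {t l : ℂ} (ht : ‖t‖ = 1) (h : Tendsto f (𝓝[Metric.ball 0 1] t) (𝓝 l)) :
    Tendsto (fun z => ((1 - ‖z‖ : ℝ) : ℂ) * deriv f z) (𝓝[Metric.ball 0 1] t) (𝓝 0) := by
  rw [Metric.tendsto_nhdsWithin_nhds] at h ⊢
  intro ε hε
  -- Cauchy's estimate on the circle of radius `(1 - ‖z‖) / 2` doubles `ε / 4`, leaving `ε / 2`. For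
  -- `z` within `δ / 2` of `t`, that circle lies within `δ` of `t`.
  obtain ⟨δ, hδ, hf'⟩ := h (ε / 4) (by positivity)
  refine ⟨δ / 2, by positivity, fun z hz hzt => ?_⟩
  rw [mem_ball_zero_iff] at hz
  have hd : 0 < 1 - ‖z‖ := by linarith
  have hdt : 1 - ‖z‖ < δ / 2 := by
    rw [dist_comm, dist_eq_norm] at hzt
    have := norm_sub_norm_le t z
    linarith
  have hsub : Metric.closedBall z ((1 - ‖z‖) / 2) ⊆ Metric.ball 0 1 := fun w hw => by
    rw [mem_closedBall_iff_norm] at hw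
    rw [mem_ball_zero_iff]
    have := norm_sub_norm_le w z
    linarith
  have hg : DiffContOnCl ℂ (fun w => f w - l) (Metric.ball z ((1 - ‖z‖) / 2)) :=
    (hf.mono hsub).diffContOnCl_ball Set.Subset.rfl |>.sub_const l
  have hder := Complex.norm_deriv_le_of_forall_mem_sphere_norm_le (half_pos hd) hg
    (C := ε / 4) fun w hw => by
      rw [← dist_eq_norm]
      refine (hf' (hsub (Metric.sphere_subset_closedBall hw)) ?_).le
      have := dist_triangle w z t
      rw [mem_sphere_iff_norm, ← dist_eq_norm] at hw
      linarith
  rw [deriv_sub_const_fun, le_div_iff₀ (half_pos hd)] at hder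
  rw [dist_zero_right, norm_mul, Complex.norm_real, Real.norm_eq_abs, abs_of_pos hd]
  linarith

theorem exists_eq_const_of_re_eq_zero {f : ℂ → ℂ} (hf : DiffContOnCl ℂ f (Metric.ball 0 1))
    (h : ∀ z ∈ Metric.sphere (0 : ℂ) 1, (f z).re = 0) :
    ∃ c : ℝ, ∀ z ∈ Metric.ball (0 : ℂ) 1, f z = c * I := by
  -- The maximum modulus principle for `exp ∘ g`, whose modulus is `exp (Re g)`. Applied to `f` and
  -- `-f` it gives both inequalities.
  have key : ∀ g : ℂ → ℂ, DiffContOnCl ℂ g (Metric.ball 0 1) →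
      (∀ z ∈ Metric.sphere (0 : ℂ) 1, (g z).re = 0) →
      ∀ z ∈ Metric.ball (0 : ℂ) 1, (g z).re ≤ 0 := fun g hg hg0 z hz => by
    have h1 := Complex.norm_le_of_forall_mem_frontier_norm_le (C := 1) Metric.isBounded_ball
      (Complex.differentiable_exp.comp_diffContOnCl hg) (fun w hw => by
        rw [frontier_ball (0 : ℂ) one_ne_zero] at hw
        rw [Function.comp_apply, Complex.norm_exp, hg0 w hw, Real.exp_zero]) (subset_closure hz)
    rwa [Function.comp_apply, Complex.norm_exp, Real.exp_le_one_iff] at h1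
  have hre : ∀ z ∈ Metric.ball (0 : ℂ) 1, (f z).re = 0 := fun z hz => by
    refine le_antisymm (key f hf h z hz) ?_
    have := key (-f) hf.neg (fun w hw => by simp [h w hw]) z hz
    simpa using this
  obtain ⟨c, hc⟩ := AnalyticOnNhd.eq_re_add_const_mul_I_of_re_eq_const
    (hf.differentiableOn.analyticOnNhd Metric.isOpen_ball) hre Metric.isOpen_ball
    (Metric.isConnected_ball one_pos)
  refine ⟨c, fun z hz => ?_⟩
  rw [hc z hz]
  simp

end

/-! ### The biharmonic algebra as dual numbers, and its plane as a copy of `ℂ`. -/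

namespace Biharm

/-- The linear isomorphism sending `p e₁ + q (e₁ + i e₂)` to `(p, q)`; here `e₁ + i e₂` is
nilpotent. -/
def partsEquiv : Biharm ≃ₗ[ℂ] ℂ × ℂ where
  toFun a := (a.coeff₁ + I * a.coeff₂, -I * a.coeff₂)
  invFun p := ofCoeffs (p.1 + p.2) (I * p.2)
  map_add' a b := by
    change (a.coeff₁ + b.coeff₁ + I * (a.coeff₂ + b.coeff₂), -I * (a.coeff₂ + b.coeff₂)) = _
    ext <;> simp <;> ring
  map_smul' c a := by
    change (c * a.coeff₁ + I * (c * a.coeff₂), -I * (c * a.coeff₂)) = _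
    ext <;> simp <;> ring
  left_inv a := by
    apply QuadraticAlgebra.ext
    · change a.coeff₁ + I * a.coeff₂ + -I * a.coeff₂ = a.coeff₁
      ring
    · change I * (-I * a.coeff₂) = a.coeff₂
      linear_combination (-a.coeff₂) * Complex.I_sq
  right_inv p := by
    ext
    · simp only [coeff₁_ofCoeffs, coeff₂_ofCoeffs]
      linear_combination p.2 * Complex.I_sq
    · simp only [coeff₂_ofCoeffs]
      linear_combination (-p.2) * Complex.I_sq

instance : FiniteDimensional ℂ Biharm := partsEquiv.symm.finiteDimensional

instance : CompleteSpace Biharm := FiniteDimensional.complete ℂ Biharm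

/-- `partsEquiv` as a homeomorphism. -/
def partsCLE : Biharm ≃L[ℂ] ℂ × ℂ := partsEquiv.toContinuousLinearEquiv

/-- The coefficient `p` of `a = p e₁ + q (e₁ + i e₂)`. -/
def scalarPart : Biharm →L[ℂ] ℂ := (ContinuousLinearMap.fst ℂ ℂ ℂ).comp partsCLE.toContinuousLinearMap

/-- The coefficient `q` of `a = p e₁ + q (e₁ + i e₂)`. -/
def nilPart : Biharm →L[ℂ] ℂ := (ContinuousLinearMap.snd ℂ ℂ ℂ).comp partsCLE.toContinuousLinearMap

theorem scalarPart_apply (a : Biharm) : scalarPart a = a.coeff₁ + I * a.coeff₂ := rfl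

theorem nilPart_apply (a : Biharm) : nilPart a = -I * a.coeff₂ := rfl

theorem ext_parts {a b : Biharm} (h₁ : scalarPart a = scalarPart b)
    (h₂ : nilPart a = nilPart b) : a = b :=
  partsCLE.injective (Prod.ext h₁ h₂)

theorem tendsto_iff_parts {α : Type*} {l : Filter α} {f : α → Biharm} {a : Biharm} :
    Tendsto f l (𝓝 a) ↔ Tendsto (fun x => scalarPart (f x)) l (𝓝 (scalarPart a)) ∧
      Tendsto (fun x => nilPart (f x)) l (𝓝 (nilPart a)) := by
  rw [partsCLE.toHomeomorph.isInducing.tendsto_nhds_iff]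
  exact Prod.tendsto_iff _ _

theorem exists_parts (p q : ℂ) : ∃ a : Biharm, scalarPart a = p ∧ nilPart a = q :=
  ⟨partsCLE.symm (p, q), congrArg Prod.fst (partsCLE.apply_symm_apply (p, q)),
    congrArg Prod.snd (partsCLE.apply_symm_apply (p, q))⟩

theorem scalarPart_mul (a b : Biharm) : scalarPart (a * b) = scalarPart a * scalarPart b := by
  have h1 : (a * b).coeff₁ = a.coeff₁ * b.coeff₁ + 1 * a.coeff₂ * b.coeff₂ := rfl
  have h2 : (a * b).coeff₂ = a.coeff₁ * b.coeff₂ + a.coeff₂ * b.coeff₁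
    + 2 * I * a.coeff₂ * b.coeff₂ := rfl
  simp only [scalarPart_apply, h1, h2]
  linear_combination a.coeff₂ * b.coeff₂ * Complex.I_sq

theorem nilPart_mul (a b : Biharm) :
    nilPart (a * b) = scalarPart a * nilPart b + nilPart a * scalarPart b := by
  have h2 : (a * b).coeff₂ = a.coeff₁ * b.coeff₂ + a.coeff₂ * b.coeff₁
    + 2 * I * a.coeff₂ * b.coeff₂ := rfl
  simp only [scalarPart_apply, nilPart_apply, h2]
  ring

@[simp] theorem scalarPart_one : scalarPart (1 : Biharm) = 1 := by
  change (1 : ℂ) + I * 0 = 1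
  ring

@[simp] theorem nilPart_one : nilPart (1 : Biharm) = 0 := by
  change -I * (0 : ℂ) = 0
  ring

/-- The inverse of `p + q ρ` is `p⁻¹ - q p⁻² ρ`. -/
theorem isUnit_iff_scalarPart {a : Biharm} : IsUnit a ↔ scalarPart a ≠ 0 := by
  constructor
  · rintro ⟨u, rfl⟩ h
    have := congrArg scalarPart u.mul_inv
    rw [scalarPart_mul, h, zero_mul, scalarPart_one] at this
    exact zero_ne_one this
  · intro h
    obtain ⟨b, hb1, hb2⟩ := exists_parts (scalarPart a)⁻¹ (-nilPart a / scalarPart a ^ 2)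
    refine IsUnit.of_mul_eq_one b (ext_parts ?_ ?_)
    · rw [scalarPart_mul, hb1, scalarPart_one, mul_inv_cancel₀ h]
    · rw [nilPart_mul, hb1, hb2, nilPart_one]
      field_simp
      ring

/-- Also valid for non-units: `Ring.inverse` and the inverse in `ℂ` both take the value `0` there.
-/
theorem scalarPart_inverse (a : Biharm) :
    scalarPart (Ring.inverse a) = (scalarPart a)⁻¹ := by
  by_cases h : scalarPart a = 0
  · rw [Ring.inverse_non_unit _ fun hu => isUnit_iff_scalarPart.1 hu h, h, map_zero, inv_zero]
  · have := congrArg scalarPart (Ring.mul_inverse_cancel a (isUnit_iff_scalarPart.2 h))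
    rw [scalarPart_mul, scalarPart_one] at this
    exact eq_inv_of_mul_eq_one_right this

theorem nilPart_inverse (a : Biharm) :
    nilPart (Ring.inverse a) = -nilPart a * ((scalarPart a)⁻¹) ^ 2 := by
  by_cases h : scalarPart a = 0
  · rw [Ring.inverse_non_unit _ fun hu => isUnit_iff_scalarPart.1 hu h, h]
    simp
  · have := congrArg nilPart (Ring.mul_inverse_cancel a (isUnit_iff_scalarPart.2 h))
    rw [nilPart_mul, nilPart_one, scalarPart_inverse] at this
    field_simp
    field_simp at this
    linear_combination this

theorem U₁_eq (a : Biharm) : U₁ a = (scalarPart a).re + (nilPart a).re := by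
  rw [← Complex.add_re, scalarPart_apply, nilPart_apply, U₁]
  congr 1
  ring

theorem U₄_eq (a : Biharm) : U₄ a = (nilPart a).re := by
  rw [nilPart_apply, U₄]
  simp

theorem scalarPart_e₂ : scalarPart e₂ = I := by
  rw [scalarPart_apply, e₂, coeff₁_ofCoeffs, coeff₂_ofCoeffs]
  ring

theorem nilPart_e₂ : nilPart e₂ = -I := by
  rw [nilPart_apply, e₂, coeff₂_ofCoeffs]
  ring

theorem scalarPart_real_smul (r : ℝ) (a : Biharm) : scalarPart (r • a) = r * scalarPart a := by
  rw [← Complex.coe_smul, map_smul, smul_eq_mul]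

theorem nilPart_real_smul (r : ℝ) (a : Biharm) : nilPart (r • a) = r * nilPart a := by
  rw [← Complex.coe_smul, map_smul, smul_eq_mul]

theorem coe_pt (x y : ℝ) : (pt x y : Biharm) = ofCoeffs x y := by
  rw [ofCoeffs_eq, Complex.coe_smul, Complex.coe_smul]
  rfl

theorem norm_pt (x y : ℝ) : ‖pt x y‖ = ‖(⟨x, y⟩ : ℂ)‖ := by
  change ‖(pt x y : Biharm)‖ = _
  rw [coe_pt, norm_eq, coeff₁_ofCoeffs, coeff₂_ofCoeffs, Complex.norm_real, Complex.norm_real,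
    Complex.norm_eq_sqrt_sq_add_sq]
  simp

/-- The isometry `x + i y ↦ x e₁ + y e₂` of `ℂ` onto the biharmonic plane. -/
def planeEquiv : ℂ ≃ₗᵢ[ℝ] plane :=
  LinearIsometryEquiv.ofSurjective
    { toFun := fun z => pt z.re z.im
      map_add' := fun z w => by
        apply Subtype.ext
        change (z + w).re • e₁ + (z + w).im • e₂ = z.re • e₁ + z.im • e₂ + (w.re • e₁ + w.im • e₂)
        rw [Complex.add_re, Complex.add_im]
        module
      map_smul' := fun r z => by
        apply Subtype.ext
        change (r • z).re • e₁ + (r • z).im • e₂ = r • (z.re • e₁ + z.im • e₂)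
        rw [Complex.smul_re, Complex.smul_im, smul_eq_mul, smul_eq_mul]
        module
      norm_map' := fun z => norm_pt z.re z.im }
    (by
      rintro ⟨a, ha⟩
      obtain ⟨x, y, rfl⟩ := Submodule.mem_span_pair.1 ha
      exact ⟨⟨x, y⟩, rfl⟩)

theorem planeEquiv_apply (z : ℂ) : planeEquiv z = pt z.re z.im := rfl

theorem scalarPart_planeEquiv (z : ℂ) : scalarPart (planeEquiv z : Biharm) = z := by
  rw [planeEquiv_apply, coe_pt, scalarPart_apply, coeff₁_ofCoeffs, coeff₂_ofCoeffs, mul_comm,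
    Complex.re_add_im]

theorem nilPart_planeEquiv (z : ℂ) : nilPart (planeEquiv z : Biharm) = -I * z.im := by
  rw [planeEquiv_apply, coe_pt, nilPart_apply, coeff₂_ofCoeffs]

theorem planeEquiv_mem_disk {z : ℂ} : planeEquiv z ∈ disk ↔ z ∈ Metric.ball (0 : ℂ) 1 := by
  rw [disk, mem_ball_zero_iff, mem_ball_zero_iff, LinearIsometryEquiv.norm_map]

theorem planeEquiv_mem_circle {z : ℂ} :
    planeEquiv z ∈ circle ↔ z ∈ Metric.sphere (0 : ℂ) 1 := by
  rw [circle, mem_sphere_zero_iff_norm, mem_sphere_zero_iff_norm, LinearIsometryEquiv.norm_map]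

theorem closure_disk : closure disk = Metric.closedBall 0 1 := closure_ball _ one_ne_zero

theorem frontier_disk : frontier disk = circle := frontier_ball _ one_ne_zero

/-- Boundary data as a function on the unit circle of `ℂ`. -/
def onCircle (u : plane → ℝ) (t : Circle) : ℝ := u (planeEquiv t)

/-! ### Components of the biharmonic Schwarz integral. -/

section

variable {u : plane → ℝ}

theorem pt_cos_sin (θ : ℝ) : pt (Real.cos θ) (Real.sin θ) = planeEquiv (Circle.exp θ) := by
  rw [planeEquiv_apply, Circle.coe_exp, Complex.exp_ofReal_mul_I_re, Complex.exp_ofReal_mul_I_im]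

theorem pt_neg_sin_cos (θ : ℝ) :
    pt (-Real.sin θ) (Real.cos θ) = planeEquiv (I * Circle.exp θ) := by
  rw [planeEquiv_apply, Circle.coe_exp, Complex.I_mul_re, Complex.I_mul_im,
    Complex.exp_ofReal_mul_I_re, Complex.exp_ofReal_mul_I_im]

theorem circle_im_eq (t : Circle) : ((t : ℂ).im : ℂ) = (t - (t : ℂ)⁻¹) / (2 * I) := by
  rw [Complex.im_eq_sub_conj, ← Circle.coe_inv_eq_conj, Circle.coe_inv]

theorem circle_re_eq (t : Circle) : ((t : ℂ).re : ℂ) = (t + (t : ℂ)⁻¹) / 2 := by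
  rw [Complex.re_eq_add_conj, ← Circle.coe_inv_eq_conj, Circle.coe_inv]

/-- Both components are computed pointwise under the integral. In the nilpotent one, the only
non-holomorphic dependence on `z` is the linear factor `z.im`. -/
theorem parts_schwarz (hu : Continuous (onCircle u)) {z : ℂ} (hz : ‖z‖ < 1) :
    scalarPart (schwarz u (planeEquiv z)) = schwarzCircle (onCircle u) z ∧
    nilPart (schwarz u (planeEquiv z)) =
      -I * z.im * schwarzCircleDeriv (onCircle u) z + schwarzNil (onCircle u) z := by
  have hπ : (π : ℂ) ≠ 0 := Complex.ofReal_ne_zero.2 Real.pi_ne_zero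
  set v := onCircle u with hv
  set G : ℝ → Biharm := fun θ =>
    u (pt (Real.cos θ) (Real.sin θ)) •
      (((pt (Real.cos θ) (Real.sin θ) : Biharm) + planeEquiv z) *
        Ring.inverse ((pt (Real.cos θ) (Real.sin θ) : Biharm) - planeEquiv z) *
        Ring.inverse (pt (Real.cos θ) (Real.sin θ) : Biharm)) *
      (pt (-Real.sin θ) (Real.cos θ) : Biharm) with hG
  have hu' : ∀ θ : ℝ, u (planeEquiv (Circle.exp θ)) = v (Circle.exp θ) := fun _ => rfl
  have hs : ∀ θ, scalarPart (G θ) =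
      I * (2 * (v (Circle.exp θ) * Circle.exp θ * (((Circle.exp θ : ℂ) - z)⁻¹) ^ 1)
        - v (Circle.exp θ)) := fun θ => by
    have h1 := circle_exp_sub_ne_zero θ hz
    have h2 := (Circle.exp θ).coe_ne_zero
    simp only [hG, pt_cos_sin, pt_neg_sin_cos, hu', scalarPart_mul, scalarPart_real_smul, map_add,
      map_sub, scalarPart_inverse, scalarPart_planeEquiv]
    generalize (Circle.exp θ : ℂ) = t at *
    field_simp
    ring
  have hn : ∀ θ, nilPart (G θ) =
      I * (-I * z.im * 2 * (v (Circle.exp θ) * Circle.exp θ * (((Circle.exp θ : ℂ) - z)⁻¹) ^ 2)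
        + (z * (v (Circle.exp θ) * Circle.exp θ * (((Circle.exp θ : ℂ) - z)⁻¹) ^ 2)
        - v (Circle.exp θ) * (Circle.exp θ : ℂ)⁻¹ * (((Circle.exp θ : ℂ) - z)⁻¹) ^ 1
        - v (Circle.exp θ) * (((Circle.exp θ : ℂ) - z)⁻¹) ^ 2
        + v (Circle.exp θ) * ((Circle.exp θ : ℂ)⁻¹) ^ 2)) := fun θ => by
    have h1 := circle_exp_sub_ne_zero θ hz
    have h2 := (Circle.exp θ).coe_ne_zero
    have h3 := circle_im_eq (Circle.exp θ)
    have h4 := circle_re_eq (Circle.exp θ)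
    simp only [hG, pt_cos_sin, pt_neg_sin_cos, hu', scalarPart_mul, scalarPart_real_smul, map_add,
      map_sub, scalarPart_inverse, scalarPart_planeEquiv, nilPart_mul, nilPart_inverse,
      nilPart_real_smul, nilPart_planeEquiv, Complex.I_mul_im]
    -- Expressing `Im t` and `Re t` through `t` and `t⁻¹` turns the claim into an identity of
    -- rational functions of `t`.
    rw [h3, h4]
    generalize (Circle.exp θ : ℂ) = t at *
    have h5 := Complex.I_ne_zero
    field_simp
    ring
  have hc1 := continuous_cauchyPow_integrand (continuous_circle_data_mul hu) 1 hz
  have hc2 := continuous_cauchyPow_integrand (continuous_circle_data_mul hu) 2 hz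
  have hc3 := continuous_cauchyPow_integrand (continuous_circle_data_mul_inv hu) 1 hz
  have hc4 := continuous_cauchyPow_integrand (continuous_circle_data hu) 2 hz
  have hc5 := continuous_circle_data hu
  have hc6 : Continuous fun θ : ℝ => (v (Circle.exp θ) : ℂ) * ((Circle.exp θ : ℂ)⁻¹) ^ 2 :=
    hc5.mul ((Continuous.inv₀ (by fun_prop) fun θ => (Circle.exp θ).coe_ne_zero).pow 2)
  have hGs : Continuous fun θ => scalarPart (G θ) := by
    simp_rw [hs]
    exact continuous_const.mul ((continuous_const.mul hc1).sub hc5)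
  have hGn : Continuous fun θ => nilPart (G θ) := by
    simp_rw [hn]
    exact continuous_const.mul ((continuous_const.mul hc2).add
      ((((continuous_const.mul hc2).sub hc3).sub hc4).add hc6))
  have hG' : Continuous G := by
    have : Continuous fun θ => partsCLE (G θ) := hGs.prodMk hGn
    exact (partsCLE.symm.continuous.comp this).congr fun θ => partsCLE.symm_apply_apply (G θ)
  have hint : schwarz u (planeEquiv z) = (1 / (2 * π * I) : ℂ) • ∫ θ in (0 : ℝ)..2 * π, G θ := rfl
  rw [hint, map_smul, map_smul,
    ← ContinuousLinearMap.intervalIntegral_comp_comm scalarPart (hG'.intervalIntegrable _ _),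
    ← ContinuousLinearMap.intervalIntegral_comp_comm nilPart (hG'.intervalIntegrable _ _)]
  simp_rw [hs, hn]
  constructor
  · rw [intervalIntegral.integral_const_mul, intervalIntegral.integral_sub,
      intervalIntegral.integral_const_mul, schwarzCircle, cauchyPow, smul_eq_mul]
    · have h5 := Complex.I_ne_zero
      field_simp
    · exact (continuous_const.mul hc1).intervalIntegrable _ _
    · exact hc5.intervalIntegrable _ _
  · rw [intervalIntegral.integral_const_mul, intervalIntegral.integral_add,
      intervalIntegral.integral_add, intervalIntegral.integral_sub, intervalIntegral.integral_sub,
      intervalIntegral.integral_const_mul, intervalIntegral.integral_const_mul, smul_eq_mul,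
      schwarzCircleDeriv, schwarzNil, circleCoeff, cauchyPow, cauchyPow, cauchyPow]
    · have h5 := Complex.I_ne_zero
      field_simp
    · exact (continuous_const.mul hc2).intervalIntegrable _ _
    · exact hc3.intervalIntegrable _ _
    · exact ((continuous_const.mul hc2).sub hc3).intervalIntegrable _ _
    · exact hc4.intervalIntegrable _ _
    · exact (((continuous_const.mul hc2).sub hc3).sub hc4).intervalIntegrable _ _
    · exact hc6.intervalIntegrable _ _
    · exact (continuous_const.mul hc2).intervalIntegrable _ _
    · exact ((((continuous_const.mul hc2).sub hc3).sub hc4).add hc6).intervalIntegrable _ _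

end

/-! ### Consequences of the Dini condition. -/

section

variable {u : plane → ℝ}

theorem modulus_mono (u : plane → ℝ) : Monotone (modulus u) := fun _ _ h =>
  iSup_mono fun _ => iSup_mono fun _ => iSup_mono fun _ => iSup_mono fun _ =>
    iSup_const_mono fun h' => h'.trans h

theorem le_modulus (u : plane → ℝ) {s t : Circle} {ε : ℝ} (h : ‖(s : ℂ) - t‖ ≤ ε) :
    ENNReal.ofReal |onCircle u s - onCircle u t| ≤ modulus u ε := by
  have hmem : ∀ c : Circle, planeEquiv c ∈ circle := fun c =>
    planeEquiv_mem_circle.2 (mem_sphere_zero_iff_norm.2 c.norm_coe)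
  have h' : ‖planeEquiv (s : ℂ) - planeEquiv t‖ ≤ ε := by
    rwa [← map_sub, LinearIsometryEquiv.norm_map]
  exact le_iSup_of_le _ (le_iSup_of_le (hmem s) (le_iSup_of_le _ (le_iSup_of_le (hmem t)
    (le_iSup_of_le h' le_rfl))))

theorem lintegral_Ioc_inv_eq_top :
    ∫⁻ η in Set.Ioc (0 : ℝ) 1, (ENNReal.ofReal η)⁻¹ = ∞ := by
  by_contra h
  have hint : IntervalIntegrable (fun x : ℝ => x⁻¹) MeasureTheory.volume 0 1 := by
    rw [intervalIntegrable_iff_integrableOn_Ioc_of_le zero_le_one]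
    refine ⟨measurable_inv.aestronglyMeasurable, ?_⟩
    rw [MeasureTheory.hasFiniteIntegral_iff_enorm]
    refine lt_of_le_of_lt (le_of_eq ?_) (lt_top_iff_ne_top.2 h)
    refine MeasureTheory.setLIntegral_congr_fun measurableSet_Ioc fun η hη => ?_
    rw [← ENNReal.ofReal_inv_of_pos hη.1, Real.enorm_of_nonneg (inv_nonneg.2 hη.1.le)]
  rw [intervalIntegrable_inv_iff] at hint
  simp at hint

/-- Otherwise the Dini integral would dominate `c` times the divergent integral of `1 / η`. -/
theorem DiniCondition.exists_modulus_lt (hu : DiniCondition u) {c : ℝ≥0∞} (hc : c ≠ 0) :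
    ∃ η : ℝ, 0 < η ∧ modulus u η < c := by
  by_contra! h
  refine hu.ne (top_le_iff.1 ?_)
  calc ∞ = c * ∫⁻ η in Set.Ioc (0 : ℝ) 1, (ENNReal.ofReal η)⁻¹ := by
        rw [lintegral_Ioc_inv_eq_top, ENNReal.mul_top hc]
    _ = ∫⁻ η in Set.Ioc (0 : ℝ) 1, c * (ENNReal.ofReal η)⁻¹ :=
        (MeasureTheory.lintegral_const_mul _ (by fun_prop)).symm
    _ ≤ _ := by
        refine MeasureTheory.setLIntegral_mono' measurableSet_Ioc fun η hη => ?_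
        rw [ENNReal.div_eq_inv_mul, mul_comm]
        gcongr
        exact h η hη.1

theorem DiniCondition.continuous (hu : DiniCondition u) : Continuous (onCircle u) := by
  rw [Metric.continuous_iff]
  intro t ε hε
  obtain ⟨η, hη, hlt⟩ := hu.exists_modulus_lt (c := ENNReal.ofReal ε) (by simpa using hε)
  refine ⟨η, hη, fun s hs => ?_⟩
  have h1 : ‖(s : ℂ) - t‖ ≤ η := by
    rw [← dist_eq_norm]
    exact hs.le
  rw [Real.dist_eq]
  exact (ENNReal.ofReal_lt_ofReal_iff hε).1 ((le_modulus u h1).trans_lt hlt)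

theorem modulus_lt_top (hu : Continuous (onCircle u)) (η : ℝ) : modulus u η < ∞ := by
  obtain ⟨M, hM⟩ := isCompact_univ.exists_bound_of_continuousOn hu.continuousOn
  have hM' : ∀ ζ ∈ circle, |u ζ| ≤ M := fun ζ hζ => by
    obtain ⟨z, rfl⟩ := planeEquiv.surjective ζ
    have hz := planeEquiv_mem_circle.1 hζ
    exact hM ⟨z, hz⟩ (Set.mem_univ _)
  refine lt_of_le_of_lt (b := ENNReal.ofReal (M + M)) ?_ ENNReal.ofReal_lt_top
  refine iSup_le fun ζ₁ => iSup_le fun h₁ => iSup_le fun ζ₂ => iSup_le fun h₂ => iSup_le fun _ => ?_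
  exact ENNReal.ofReal_le_ofReal ((abs_sub _ _).trans (add_le_add (hM' _ h₁) (hM' _ h₂)))

/-- The majorant is the modulus at `|θ|` divided by `|θ|`, because a chord is no longer than its
arc. -/
theorem DiniCondition.hasDiniBound (hu : DiniCondition u) : HasDiniBound (onCircle u) := by
  have htop := modulus_lt_top hu.continuous
  have hmono : Monotone fun x => (modulus u x).toReal := fun x y h =>
    ENNReal.toReal_mono (htop y).ne (modulus_mono u h)
  refine ⟨fun θ => (modulus u |θ|).toReal / |θ|, ?_, fun s θ _ => ?_⟩
  · have hpos : IntervalIntegrable (fun θ : ℝ => (modulus u |θ|).toReal / |θ|)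
        MeasureTheory.volume 0 π := by
      refine IntervalIntegrable.trans (b := 1) ?_ ?_
      · rw [intervalIntegrable_iff_integrableOn_Ioc_of_le zero_le_one]
        refine ⟨Measurable.aestronglyMeasurable
          ((hmono.measurable.comp measurable_norm).div measurable_norm), ?_⟩
        rw [MeasureTheory.hasFiniteIntegral_iff_enorm]
        refine lt_of_le_of_lt (le_of_eq ?_) hu
        refine MeasureTheory.setLIntegral_congr_fun measurableSet_Ioc fun η hη => ?_
        rw [abs_of_pos hη.1, Real.enorm_of_nonneg (div_nonneg ENNReal.toReal_nonneg hη.1.le),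
          ENNReal.ofReal_div_of_pos hη.1, ENNReal.ofReal_toReal (htop η).ne]
      -- The Dini integral only covers `(0, 1]`; on `[1, π]` the modulus is finite and monotone and
      -- `1 / θ` is continuous.
      · have h1 : IntervalIntegrable (fun θ : ℝ => (modulus u θ).toReal * θ⁻¹)
            MeasureTheory.volume 1 π := by
          refine (hmono.monotoneOn _).intervalIntegrable.mul_continuousOn
            (continuousOn_id.inv₀ fun x hx => ?_)
          rw [Set.uIcc_of_le (by linarith [Real.pi_gt_three])] at hx
          exact (lt_of_lt_of_le one_pos hx.1).ne'
        refine h1.congr fun θ hθ => ?_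
        rw [Set.uIoc_of_le (by linarith [Real.pi_gt_three])] at hθ
        rw [abs_of_pos (one_pos.trans hθ.1), div_eq_mul_inv]
    refine IntervalIntegrable.trans (b := 0) ?_ hpos
    rw [IntervalIntegrable.iff_comp_neg]
    simpa using hpos.symm
  · rcases eq_or_ne θ 0 with rfl | hθ
    · simp
    rw [mul_div_cancel₀ _ (abs_ne_zero.2 hθ)]
    refine (ENNReal.ofReal_le_iff_le_toReal (htop _).ne).1 (le_modulus u ?_)
    rw [Circle.coe_mul]
    have : (s : ℂ) * Circle.exp θ - s = s * (Circle.exp θ - 1) := by ring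
    rw [this, norm_mul, Circle.norm_coe, one_mul]
    exact norm_circle_exp_sub_one_le θ

end

/-! ### Monogenic functions, uniqueness, and boundary limits of the nilpotent part. -/

section

/-- The monogenic difference quotient has a limit exactly if its two components, read in the
complex plane, have. -/
theorem tendsto_quotient_iff {Φ : plane → Biharm} {z : ℂ} {a : Biharm} :
    Tendsto (fun h : plane => (Φ (planeEquiv z + h) - Φ (planeEquiv z)) *
        Ring.inverse (h : Biharm)) (𝓝[≠] 0) (𝓝 a) ↔
      Tendsto (fun k : ℂ => (scalarPart (Φ (planeEquiv (z + k))) - scalarPart (Φ (planeEquiv z)))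
        * k⁻¹) (𝓝[≠] 0) (𝓝 (scalarPart a)) ∧
      Tendsto (fun k : ℂ => (scalarPart (Φ (planeEquiv (z + k))) - scalarPart (Φ (planeEquiv z)))
          * (I * k.im * (k⁻¹) ^ 2)
        + (nilPart (Φ (planeEquiv (z + k))) - nilPart (Φ (planeEquiv z))) * k⁻¹)
        (𝓝[≠] 0) (𝓝 (nilPart a)) := by
  have hmap : (𝓝[≠] (0 : plane)) = Filter.map planeEquiv (𝓝[≠] (0 : ℂ)) := by
    have := planeEquiv.toHomeomorph.map_punctured_nhds_eq 0
    rw [LinearIsometryEquiv.coe_toHomeomorph, map_zero] at this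
    exact this.symm
  rw [hmap, tendsto_map'_iff, tendsto_iff_parts]
  simp only [Function.comp_apply, scalarPart_mul, nilPart_mul, map_sub, scalarPart_inverse,
    nilPart_inverse, scalarPart_planeEquiv, nilPart_planeEquiv, map_add, neg_mul, neg_neg]

/-- The term `-i y F'` is exactly what compensates the nilpotent part of `h⁻¹`. The derivative has
components `F'` and `-i y F'' + G'`. -/
theorem tendsto_quotient_of_hasDerivAt {Φ : plane → Biharm} {F F' G : ℂ → ℂ} {z : ℂ}
    (hF : HasDerivAt F (F' z) z) (hF' : DifferentiableAt ℂ F' z) (hG : DifferentiableAt ℂ G z)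
    (hs : ∀ᶠ w in 𝓝 z, scalarPart (Φ (planeEquiv w)) = F w)
    (hn : ∀ᶠ w in 𝓝 z, nilPart (Φ (planeEquiv w)) = -I * w.im * F' w + G w) :
    ∃ a : Biharm, Tendsto (fun h : plane => (Φ (planeEquiv z + h) - Φ (planeEquiv z)) *
        Ring.inverse (h : Biharm)) (𝓝[≠] 0) (𝓝 a) := by
  obtain ⟨a, ha1, ha2⟩ := exists_parts (F' z) (-I * z.im * deriv F' z + deriv G z)
  have hshift : Tendsto (fun k : ℂ => z + k) (𝓝[≠] 0) (𝓝 z) := by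
    have : Tendsto (fun k : ℂ => z + k) (𝓝 0) (𝓝 (z + 0)) := tendsto_const_nhds.add tendsto_id
    rw [add_zero] at this
    exact this.mono_left nhdsWithin_le_nhds
  have dF := hasDerivAt_iff_tendsto_slope_zero.1 hF
  have dF' := hasDerivAt_iff_tendsto_slope_zero.1 hF'.hasDerivAt
  have dG := hasDerivAt_iff_tendsto_slope_zero.1 hG.hasDerivAt
  refine ⟨a, tendsto_quotient_iff.2 ⟨?_, ?_⟩⟩
  · rw [ha1]
    refine dF.congr' ?_
    filter_upwards [hshift.eventually hs] with k hk
    rw [hk, hs.self_of_nhds, smul_eq_mul, mul_comm]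
  -- The leftover of that cancellation: `Im k / k` is bounded by `1`, while `F' (z + k)` and the
  -- slope of `F` both tend to `F' z`.
  · have hrem : Tendsto (fun k : ℂ => (k.im * k⁻¹ : ℂ) * (F' (z + k) - k⁻¹ • (F (z + k) - F z)))
        (𝓝[≠] 0) (𝓝 0) := by
      have h0 : Tendsto (fun k : ℂ => F' (z + k) - k⁻¹ • (F (z + k) - F z)) (𝓝[≠] 0) (𝓝 0) := by
        have := (hF'.continuousAt.tendsto.comp hshift).sub dF
        rwa [sub_self] at this
      rw [tendsto_zero_iff_norm_tendsto_zero] at h0 ⊢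
      refine squeeze_zero (fun _ => norm_nonneg _) (fun k => ?_) h0
      rw [norm_mul]
      refine mul_le_of_le_one_left (norm_nonneg _) ?_
      rw [norm_mul, norm_inv, Complex.norm_real, Real.norm_eq_abs, ← div_eq_mul_inv]
      exact div_le_one_of_le₀ (Complex.abs_im_le_norm k) (norm_nonneg k)
    have hlim := ((dF'.const_mul (-I * z.im)).add dG).sub (hrem.const_mul I)
    rw [mul_zero, sub_zero, ← ha2] at hlim
    refine hlim.congr' ?_
    filter_upwards [hshift.eventually hs, hshift.eventually hn, self_mem_nhdsWithin] with k hk hk' hk0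
    have hk0' : k ≠ 0 := hk0
    rw [hk, hk', hs.self_of_nhds, hn.self_of_nhds, Complex.add_im, smul_eq_mul, smul_eq_mul,
      smul_eq_mul, Complex.ofReal_add]
    field_simp
    ring

theorem MonogenicOn.differentiableAt_scalarPart {Φ : plane → Biharm} (h : MonogenicOn Φ disk) {z : ℂ}
    (hz : z ∈ Metric.ball (0 : ℂ) 1) :
    DifferentiableAt ℂ (fun w => scalarPart (Φ (planeEquiv w))) z := by
  obtain ⟨a, ha⟩ := h _ (planeEquiv_mem_disk.2 hz)
  refine HasDerivAt.differentiableAt (f' := scalarPart a) (hasDerivAt_iff_tendsto_slope_zero.2 ?_)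
  refine (tendsto_quotient_iff.1 ha).1.congr fun k => ?_
  rw [smul_eq_mul, mul_comm]

/-- With a constant scalar part the cross term vanishes and the nilpotent quotient is an ordinary
complex difference quotient. -/
theorem MonogenicOn.differentiableAt_nilPart {Φ : plane → Biharm} (h : MonogenicOn Φ disk) {c : ℂ}
    (hc : ∀ w ∈ Metric.ball (0 : ℂ) 1, scalarPart (Φ (planeEquiv w)) = c) {z : ℂ}
    (hz : z ∈ Metric.ball (0 : ℂ) 1) :
    DifferentiableAt ℂ (fun w => nilPart (Φ (planeEquiv w))) z := by
  obtain ⟨a, ha⟩ := h _ (planeEquiv_mem_disk.2 hz)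
  refine HasDerivAt.differentiableAt (f' := nilPart a) (hasDerivAt_iff_tendsto_slope_zero.2 ?_)
  refine (tendsto_quotient_iff.1 ha).2.congr' ?_
  have hshift : Tendsto (fun k : ℂ => z + k) (𝓝[≠] 0) (𝓝 z) := by
    have : Tendsto (fun k : ℂ => z + k) (𝓝 0) (𝓝 (z + 0)) := tendsto_const_nhds.add tendsto_id
    rw [add_zero] at this
    exact this.mono_left nhdsWithin_le_nhds
  filter_upwards [hshift.eventually (Metric.isOpen_ball.mem_nhds hz)] with k hk
  rw [hc _ hk, hc _ hz, smul_eq_mul, sub_self, zero_mul, zero_add, mul_comm]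

/-- Solutions of the homogeneous (1-4)-problem are constant. -/
theorem IsSolution14.exists_eq_const {Φ : plane → Biharm}
    (h : IsSolution14 disk (fun _ => 0) (fun _ => 0) Φ) :
    ∃ c d : ℝ, ∀ z ∈ Metric.ball (0 : ℂ) 1,
      scalarPart (Φ (planeEquiv z)) = c * I ∧ nilPart (Φ (planeEquiv z)) = d * I := by
  have hcont : ContinuousOn (fun w => Φ (planeEquiv w)) (Metric.closedBall (0 : ℂ) 1) := by
    refine h.continuousOn.comp planeEquiv.continuous.continuousOn fun w hw => ?_
    rw [closure_disk, mem_closedBall_zero_iff, LinearIsometryEquiv.norm_map]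
    exact mem_closedBall_zero_iff.1 hw
  have hbd : ∀ w ∈ Metric.sphere (0 : ℂ) 1, (scalarPart (Φ (planeEquiv w))).re = 0 ∧
      (nilPart (Φ (planeEquiv w))).re = 0 := fun w hw => by
    have hw' : planeEquiv w ∈ frontier disk := by
      rw [frontier_disk]
      exact planeEquiv_mem_circle.2 hw
    have h1 := h.boundary₁ _ hw'
    have h4 := h.boundary₄ _ hw'
    rw [U₁_eq] at h1
    rw [U₄_eq] at h4
    exact ⟨by linarith, h4⟩
  rw [← closure_ball (0 : ℂ) one_ne_zero] at hcont
  obtain ⟨c, hc⟩ := exists_eq_const_of_re_eq_zero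
    (f := fun w => scalarPart (Φ (planeEquiv w)))
    ⟨fun w hw => (h.monogenicOn.differentiableAt_scalarPart hw).differentiableWithinAt,
      scalarPart.continuous.comp_continuousOn hcont⟩ fun w hw => (hbd w hw).1
  -- The scalar part is now known to be constant, so the nilpotent part is holomorphic.
  obtain ⟨d, hd⟩ := exists_eq_const_of_re_eq_zero
    (f := fun w => nilPart (Φ (planeEquiv w)))
    ⟨fun w hw => (h.monogenicOn.differentiableAt_nilPart hc hw).differentiableWithinAt,
      nilPart.continuous.comp_continuousOn hcont⟩ fun w hw => (hbd w hw).2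
  exact ⟨c, d, fun z hz => ⟨hc z hz, hd z hz⟩⟩

theorem MonogenicOn.congr {Φ Ψ : plane → Biharm} (h : MonogenicOn Φ disk)
    (hΨ : ∀ ζ ∈ disk, Ψ ζ = Φ ζ) : MonogenicOn Ψ disk := by
  intro ζ hζ
  obtain ⟨a, ha⟩ := h ζ hζ
  refine ⟨a, ha.congr' ?_⟩
  have hshift : Tendsto (fun k : plane => ζ + k) (𝓝[≠] 0) (𝓝 ζ) := by
    have : Tendsto (fun k : plane => ζ + k) (𝓝 0) (𝓝 (ζ + 0)) := tendsto_const_nhds.add tendsto_id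
    rw [add_zero] at this
    exact this.mono_left nhdsWithin_le_nhds
  have hopen : disk ∈ 𝓝 ζ := Metric.isOpen_ball.mem_nhds hζ
  filter_upwards [hshift.eventually hopen] with k hk
  rw [hΨ _ hk, hΨ _ hζ]

theorem IsSolution14.sub {u₁ u₄ w₁ w₄ : plane → ℝ} {Φ Ψ : plane → Biharm}
    (hΦ : IsSolution14 disk u₁ u₄ Φ) (hΨ : IsSolution14 disk w₁ w₄ Ψ) :
    IsSolution14 disk (fun ζ => u₁ ζ - w₁ ζ) (fun ζ => u₄ ζ - w₄ ζ) (fun ζ => Φ ζ - Ψ ζ) where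
  continuousOn := hΦ.continuousOn.sub hΨ.continuousOn
  monogenicOn := fun ζ hζ => by
    obtain ⟨a, ha⟩ := hΦ.monogenicOn ζ hζ
    obtain ⟨b, hb⟩ := hΨ.monogenicOn ζ hζ
    refine ⟨a - b, (ha.sub hb).congr fun h => ?_⟩
    ring
  boundary₁ := fun ζ hζ => by
    rw [← hΦ.boundary₁ ζ hζ, ← hΨ.boundary₁ ζ hζ]
    simp only [U₁_eq, map_sub, Complex.sub_re]
    ring
  boundary₄ := fun ζ hζ => by
    rw [← hΦ.boundary₄ ζ hζ, ← hΨ.boundary₄ ζ hζ]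
    simp only [U₄_eq, map_sub, Complex.sub_re]

theorem tendsto_within_disk {Φ : plane → Biharm} {z : ℂ} {L : Biharm}
    (h : Tendsto (fun w => Φ (planeEquiv w)) (𝓝[Metric.ball 0 1] z) (𝓝 L)) :
    Tendsto Φ (𝓝[disk] (planeEquiv z)) (𝓝 L) := by
  have hsymm : Tendsto planeEquiv.symm (𝓝[disk] (planeEquiv z)) (𝓝[Metric.ball 0 1] z) := by
    refine tendsto_nhdsWithin_iff.2 ⟨?_, ?_⟩
    · have := (planeEquiv.symm.continuous.tendsto (planeEquiv z)).mono_left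
        (nhdsWithin_le_nhds (s := disk))
      rwa [LinearIsometryEquiv.symm_apply_apply] at this
    · filter_upwards [self_mem_nhdsWithin] with ζ hζ
      rw [← planeEquiv_mem_disk, LinearIsometryEquiv.apply_symm_apply]
      exact hζ
  refine (h.comp hsymm).congr fun ζ => ?_
  rw [Function.comp_apply, LinearIsometryEquiv.apply_symm_apply]

/-- Near the circle the nilpotent part is `z⁻¹ c₁ + c₂` minus `(1 - |z|) (1 + |z|) S'(z) / (2 z)`,
and the last term vanishes in the limit because `S` has a boundary limit. -/
theorem tendsto_nilPart_schwarz {u : plane → ℝ} (hu : DiniCondition u) (t : Circle) :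
    Tendsto (fun z => nilPart (schwarz u (planeEquiv z))) (𝓝[Metric.ball 0 1] (t : ℂ))
      (𝓝 ((t : ℂ)⁻¹ * circleCoeff (onCircle u) 1 + circleCoeff (onCircle u) 2)) := by
  obtain ⟨l, -, hl⟩ := exists_tendsto_schwarzCircle hu.continuous hu.hasDiniBound t
  have hderiv : ∀ z ∈ Metric.ball (0 : ℂ) 1,
      HasDerivAt (schwarzCircle (onCircle u)) (schwarzCircleDeriv (onCircle u) z) z :=
    fun z hz => hasDerivAt_schwarzCircle hu.continuous (by simpa using hz)
  have h1 := tendsto_one_sub_norm_mul_deriv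
    (fun z hz => (hderiv z hz).differentiableAt.differentiableWithinAt) t.norm_coe hl
  have hinv : Tendsto (fun z : ℂ => z⁻¹) (𝓝[Metric.ball 0 1] (t : ℂ)) (𝓝 (t : ℂ)⁻¹) :=
    (tendsto_inv₀ t.coe_ne_zero).mono_left nhdsWithin_le_nhds
  have hfac : Tendsto (fun z : ℂ => ((1 + ‖z‖ : ℝ) : ℂ)) (𝓝[Metric.ball 0 1] (t : ℂ))
      (𝓝 ((1 + ‖(t : ℂ)‖ : ℝ) : ℂ)) :=
    ((by fun_prop : Continuous fun z : ℂ => ((1 + ‖z‖ : ℝ) : ℂ)).tendsto _).mono_left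
      nhdsWithin_le_nhds
  have hlim := ((hinv.mul_const (circleCoeff (onCircle u) 1)).add_const
    (circleCoeff (onCircle u) 2)).sub (((h1.mul hfac).mul hinv).div_const 2)
  rw [zero_mul, zero_mul, zero_div, sub_zero] at hlim
  refine hlim.congr' ?_
  filter_upwards [self_mem_nhdsWithin, nhdsWithin_le_nhds (isOpen_ne.mem_nhds t.coe_ne_zero)]
    with z hz hz0
  have hz0' : z ≠ 0 := hz0
  have hz' : ‖z‖ < 1 := by simpa using hz
  rw [(hderiv z hz).deriv, (parts_schwarz hu.continuous hz').2,
    schwarzNil_eq hu.continuous hz' hz0, schwarzCircleDeriv_zero, Complex.im_eq_sub_conj]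
  have hn : z * (starRingEnd ℂ) z = (‖z‖ : ℂ) ^ 2 := Complex.mul_conj' z
  have h5 := Complex.I_ne_zero
  push_cast
  field_simp
  linear_combination (-schwarzCircleDeriv (onCircle u) z) * hn

/-- The shift of the exponent comes from `dt = i t dθ`. -/
theorem moment_eq {u₁ u₄ : plane → ℝ} (h₁ : Continuous (onCircle u₁))
    (h₄ : Continuous (onCircle u₄)) (k : ℕ) :
    moment u₁ u₄ (k + 1) =
      2 * π * I * (circleCoeff (onCircle u₁) k - circleCoeff (onCircle u₄) k) := by
  have hπ : (π : ℂ) ≠ 0 := Complex.ofReal_ne_zero.2 Real.pi_ne_zero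
  have hc : ∀ {v : Circle → ℝ}, Continuous v →
      Continuous fun θ : ℝ => (v (Circle.exp θ) : ℂ) * ((Circle.exp θ : ℂ)⁻¹) ^ k := fun hv =>
    (continuous_circle_data hv).mul
      ((Continuous.inv₀ (by fun_prop) fun θ => (Circle.exp θ).coe_ne_zero).pow k)
  have e : ∀ θ : ℝ, deriv (circleMap 0 1) θ •
      (((hat u₁ (circleMap 0 1 θ) - hat u₄ (circleMap 0 1 θ) : ℝ) : ℂ) / circleMap 0 1 θ ^ (k + 1))
      = I * ((onCircle u₁ (Circle.exp θ) : ℂ) * ((Circle.exp θ : ℂ)⁻¹) ^ k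
        - (onCircle u₄ (Circle.exp θ) : ℂ) * ((Circle.exp θ : ℂ)⁻¹) ^ k) := fun θ => by
    have h0 : circleMap 0 1 θ = Circle.exp θ := by
      rw [circleMap, Circle.coe_exp]
      simp
    have h1 : ∀ u : plane → ℝ, hat u (Circle.exp θ) = onCircle u (Circle.exp θ) := fun _ => rfl
    have h2 := (Circle.exp θ).coe_ne_zero
    rw [deriv_circleMap, h0, h1, h1, smul_eq_mul, Complex.ofReal_sub, inv_pow]
    field_simp
    ring
  rw [moment, circleIntegral]
  simp_rw [e]
  rw [intervalIntegral.integral_const_mul, intervalIntegral.integral_sub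
    ((hc h₁).intervalIntegrable _ _) ((hc h₄).intervalIntegrable _ _), circleCoeff, circleCoeff]
  field_simp

end

/-! ### The explicit solution. -/

section

variable {u₁ u₄ : plane → ℝ}

theorem parts_nilpotent_unit : scalarPart (e₁ + I • e₂) = 0 ∧ nilPart (e₁ + I • e₂) = 1 := by
  have hs : scalarPart e₁ = 1 := scalarPart_one
  have hn : nilPart e₁ = 0 := nilPart_one
  rw [map_add, map_add, map_smul, map_smul, hs, hn, scalarPart_e₂, nilPart_e₂, smul_eq_mul,
    smul_eq_mul]
  constructor
  · linear_combination Complex.I_sq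
  · linear_combination -Complex.I_sq

theorem scalarPart_generalSolution (h₁ : Continuous (onCircle u₁)) (h₄ : Continuous (onCircle u₄))
    (a₁ a₂ : ℝ) {z : ℂ} (hz : ‖z‖ < 1) :
    scalarPart (generalSolution u₁ u₄ a₁ a₂ (planeEquiv z)) =
      schwarzCircle (onCircle u₁) z - schwarzCircle (onCircle u₄) z + (a₁ + a₂) * I := by
  have hs : scalarPart e₁ = 1 := scalarPart_one
  rw [generalSolution]
  simp only [map_add, scalarPart_mul, parts_nilpotent_unit.1, map_smul, scalarPart_real_smul, hs,
    scalarPart_e₂, smul_eq_mul, (parts_schwarz h₁ hz).1, (parts_schwarz h₄ hz).1]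
  linear_combination (schwarzCircle (onCircle u₄) z) * Complex.I_sq

theorem nilPart_generalSolution (h₄ : Continuous (onCircle u₄))
    (a₁ a₂ : ℝ) {z : ℂ} (hz : ‖z‖ < 1) :
    nilPart (generalSolution u₁ u₄ a₁ a₂ (planeEquiv z)) =
      nilPart (schwarz u₁ (planeEquiv z)) - nilPart (schwarz u₄ (planeEquiv z))
        + (schwarzCircle (onCircle u₄) z + (b₁ u₁ u₄ + b₂ u₁ u₄ * I) * z + b₀ u₁ u₄ - a₂ * I) := by
  have hs : scalarPart e₁ = 1 := scalarPart_one
  have hn : nilPart e₁ = 0 := nilPart_one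
  rw [generalSolution]
  simp only [map_add, nilPart_mul, parts_nilpotent_unit.1, parts_nilpotent_unit.2, map_smul,
    nilPart_real_smul, hs, hn, scalarPart_e₂, nilPart_e₂, smul_eq_mul, scalarPart_planeEquiv,
    (parts_schwarz h₄ hz).1]
  linear_combination (nilPart (schwarz u₄ (planeEquiv z))
    - schwarzCircle (onCircle u₄) z) * Complex.I_sq

theorem monogenicOn_generalSolution (h₁ : Continuous (onCircle u₁))
    (h₄ : Continuous (onCircle u₄)) (a₁ a₂ : ℝ) :
    MonogenicOn (generalSolution u₁ u₄ a₁ a₂) disk := by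
  intro ζ hζ
  obtain ⟨z, rfl⟩ := planeEquiv.surjective ζ
  have hz := planeEquiv_mem_disk.1 hζ
  have hz' : ‖z‖ < 1 := mem_ball_zero_iff.1 hz
  have hnear : ∀ᶠ w in 𝓝 z, ‖w‖ < 1 := by
    filter_upwards [Metric.isOpen_ball.mem_nhds hz] with w hw
    exact mem_ball_zero_iff.1 hw
  refine tendsto_quotient_of_hasDerivAt
    (F := fun w => schwarzCircle (onCircle u₁) w - schwarzCircle (onCircle u₄) w + (a₁ + a₂) * I)
    (F' := fun w => schwarzCircleDeriv (onCircle u₁) w - schwarzCircleDeriv (onCircle u₄) w)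
    (G := fun w => schwarzNil (onCircle u₁) w - schwarzNil (onCircle u₄) w
      + (schwarzCircle (onCircle u₄) w + (b₁ u₁ u₄ + b₂ u₁ u₄ * I) * w + b₀ u₁ u₄ - a₂ * I))
    (((hasDerivAt_schwarzCircle h₁ hz').sub (hasDerivAt_schwarzCircle h₄ hz')).add_const _)
    ((differentiableAt_schwarzCircleDeriv h₁ hz').sub (differentiableAt_schwarzCircleDeriv h₄ hz'))
    (((differentiableAt_schwarzNil h₁ hz').sub (differentiableAt_schwarzNil h₄ hz')).add
      ((((hasDerivAt_schwarzCircle h₄ hz').differentiableAt.add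
        (differentiableAt_id.const_mul _)).add_const _).sub_const _)) ?_ ?_
  · filter_upwards [hnear] with w hw
    exact scalarPart_generalSolution h₁ h₄ a₁ a₂ hw
  · filter_upwards [hnear] with w hw
    rw [nilPart_generalSolution h₄ a₁ a₂ hw, (parts_schwarz h₁ hw).2, (parts_schwarz h₄ hw).2]
    ring

theorem tendsto_generalSolution (h₁ : Continuous (onCircle u₁))
    (h₄ : Continuous (onCircle u₄)) (a₁ a₂ : ℝ) {z : ℂ} (hz : ‖z‖ < 1) :
    Tendsto (fun w => generalSolution u₁ u₄ a₁ a₂ (planeEquiv w)) (𝓝 z)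
      (𝓝 (generalSolution u₁ u₄ a₁ a₂ (planeEquiv z))) := by
  have hnear : ∀ᶠ w in 𝓝 z, ‖w‖ < 1 := by
    filter_upwards [Metric.isOpen_ball.mem_nhds (mem_ball_zero_iff.2 hz)] with w hw
    exact mem_ball_zero_iff.1 hw
  have c₁ := (hasDerivAt_schwarzCircle h₁ hz).continuousAt.tendsto
  have c₄ := (hasDerivAt_schwarzCircle h₄ hz).continuousAt.tendsto
  have d₁ := (differentiableAt_schwarzCircleDeriv h₁ hz).continuousAt.tendsto
  have d₄ := (differentiableAt_schwarzCircleDeriv h₄ hz).continuousAt.tendsto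
  have k₁ := (differentiableAt_schwarzNil h₁ hz).continuousAt.tendsto
  have k₄ := (differentiableAt_schwarzNil h₄ hz).continuousAt.tendsto
  have him : Tendsto (fun w : ℂ => -I * w.im) (𝓝 z) (𝓝 (-I * z.im)) :=
    (by fun_prop : Continuous fun w : ℂ => -I * w.im).tendsto z
  refine tendsto_iff_parts.2 ⟨?_, ?_⟩
  · rw [scalarPart_generalSolution h₁ h₄ a₁ a₂ hz]
    refine ((c₁.sub c₄).add_const _).congr' ?_
    filter_upwards [hnear] with w hw
    exact (scalarPart_generalSolution h₁ h₄ a₁ a₂ hw).symm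
  · rw [nilPart_generalSolution h₄ a₁ a₂ hz, (parts_schwarz h₁ hz).2, (parts_schwarz h₄ hz).2]
    refine ((((him.mul d₁).add k₁).sub ((him.mul d₄).add k₄)).add
      (((c₄.add (tendsto_id.const_mul (b₁ u₁ u₄ + b₂ u₁ u₄ * I : ℂ))).add_const
        (b₀ u₁ u₄ : ℂ)).sub_const (a₂ * I : ℂ))).congr' ?_
    filter_upwards [hnear] with w hw
    rw [nilPart_generalSolution h₄ a₁ a₂ hw, (parts_schwarz h₁ hw).2, (parts_schwarz h₄ hw).2]
    rfl

/-- With `D₁`, `D₂` the differences of the first and second circle coefficients, `b₁ + i b₂ = -conj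
D₁` and `b = -Re D₂`. As `t⁻¹ = conj t`, the real part of `t⁻¹ D₁ + D₂ + (b₁ + i b₂) t + b` is zero,
leaving `Re q = u₄`. -/
theorem exists_tendsto_generalSolution (hu₁ : DiniCondition u₁) (hu₄ : DiniCondition u₄)
    (a₁ a₂ : ℝ) (t : Circle) :
    ∃ L : Biharm, U₁ L = onCircle u₁ t ∧ U₄ L = onCircle u₄ t ∧
      Tendsto (fun w => generalSolution u₁ u₄ a₁ a₂ (planeEquiv w))
        (𝓝[Metric.ball 0 1] (t : ℂ)) (𝓝 L) := by
  obtain ⟨l₁, hre₁, hl₁⟩ := exists_tendsto_schwarzCircle hu₁.continuous hu₁.hasDiniBound t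
  obtain ⟨l₄, hre₄, hl₄⟩ := exists_tendsto_schwarzCircle hu₄.continuous hu₄.hasDiniBound t
  have hn₁ := tendsto_nilPart_schwarz hu₁ t
  have hn₄ := tendsto_nilPart_schwarz hu₄ t
  have hid : Tendsto (fun w : ℂ => w) (𝓝[Metric.ball 0 1] (t : ℂ)) (𝓝 t) :=
    tendsto_id.mono_left nhdsWithin_le_nhds
  have hlimn := (hn₁.sub hn₄).add (((hl₄.add (hid.const_mul (b₁ u₁ u₄ + b₂ u₁ u₄ * I : ℂ))).add_const
        (b₀ u₁ u₄ : ℂ)).sub_const (a₂ * I : ℂ))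
  have hlims := (hl₁.sub hl₄).add_const ((a₁ + a₂) * I : ℂ)
  obtain ⟨L, hLs, hLn⟩ := exists_parts (l₁ - l₄ + (a₁ + a₂) * I)
    (((t : ℂ)⁻¹ * circleCoeff (onCircle u₁) 1 + circleCoeff (onCircle u₁) 2)
      - ((t : ℂ)⁻¹ * circleCoeff (onCircle u₄) 1 + circleCoeff (onCircle u₄) 2)
      + (l₄ + (b₁ u₁ u₄ + b₂ u₁ u₄ * I) * t + b₀ u₁ u₄ - a₂ * I))
  have hU₄ : U₄ L = onCircle u₄ t := by
    have hπ := Real.pi_ne_zero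
    have m1 := moment_eq hu₁.continuous hu₄.continuous 1
    have m2 := moment_eq hu₁.continuous hu₄.continuous 2
    set D₁ := circleCoeff (onCircle u₁) 1 - circleCoeff (onCircle u₄) 1 with hD₁
    set D₂ := circleCoeff (onCircle u₁) 2 - circleCoeff (onCircle u₄) 2 with hD₂
    have hb₁ : b₁ u₁ u₄ = -D₁.re := by
      rw [b₁, m1]
      simp
      field_simp
    have hb₂ : b₂ u₁ u₄ = D₁.im := by
      rw [b₂, m1]
      simp
      field_simp
    have hb₀ : b₀ u₁ u₄ = -D₂.re := by
      rw [b₀, m2]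
      simp
      field_simp
    rw [U₄_eq, hLn, ← hre₄, hb₁, hb₂, hb₀, ← Circle.coe_inv, Circle.coe_inv_eq_conj]
    have e : (starRingEnd ℂ) (t : ℂ) * circleCoeff (onCircle u₁) 1 + circleCoeff (onCircle u₁) 2
      - ((starRingEnd ℂ) (t : ℂ) * circleCoeff (onCircle u₄) 1 + circleCoeff (onCircle u₄) 2)
      = (starRingEnd ℂ) (t : ℂ) * D₁ + D₂ := by
        rw [hD₁, hD₂]
        ring
    rw [e]
    simp
    ring
  refine ⟨L, ?_, hU₄, tendsto_iff_parts.2 ⟨?_, ?_⟩⟩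
  · rw [U₄_eq] at hU₄
    rw [U₁_eq, hU₄, hLs, ← hre₁, ← hre₄]
    simp
  · rw [hLs]
    refine hlims.congr' ?_
    filter_upwards [self_mem_nhdsWithin] with w hw
    exact (scalarPart_generalSolution hu₁.continuous hu₄.continuous a₁ a₂
      (mem_ball_zero_iff.1 hw)).symm
  · rw [hLn]
    refine hlimn.congr' ?_
    filter_upwards [self_mem_nhdsWithin] with w hw
    exact (nilPart_generalSolution hu₄.continuous a₁ a₂
      (mem_ball_zero_iff.1 hw)).symm

theorem exists_isSolution14 (hu₁ : DiniCondition u₁) (hu₄ : DiniCondition u₄) (a₁ a₂ : ℝ) :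
    ∃ Φ : plane → Biharm, IsSolution14 disk u₁ u₄ Φ ∧
      ∀ ζ ∈ disk, Φ ζ = generalSolution u₁ u₄ a₁ a₂ ζ := by
  have hin : ∀ ζ ∈ disk, Tendsto (generalSolution u₁ u₄ a₁ a₂) (𝓝[disk] ζ)
      (𝓝 (generalSolution u₁ u₄ a₁ a₂ ζ)) := fun ζ hζ => by
    obtain ⟨z, rfl⟩ := planeEquiv.surjective ζ
    exact tendsto_within_disk ((tendsto_generalSolution hu₁.continuous hu₄.continuous a₁ a₂
      (mem_ball_zero_iff.1 (planeEquiv_mem_disk.1 hζ))).mono_left nhdsWithin_le_nhds)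
  have hbd : ∀ ζ ∈ circle, ∃ L : Biharm, U₁ L = u₁ ζ ∧ U₄ L = u₄ ζ ∧
      Tendsto (generalSolution u₁ u₄ a₁ a₂) (𝓝[disk] ζ) (𝓝 L) := fun ζ hζ => by
    obtain ⟨z, rfl⟩ := planeEquiv.surjective ζ
    obtain ⟨L, h1, h4, hL⟩ := exists_tendsto_generalSolution hu₁ hu₄ a₁ a₂
      ⟨z, planeEquiv_mem_circle.1 hζ⟩
    exact ⟨L, h1, h4, tendsto_within_disk hL⟩
  have heq : ∀ ζ ∈ disk, extendFrom disk (generalSolution u₁ u₄ a₁ a₂) ζ =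
      generalSolution u₁ u₄ a₁ a₂ ζ := fun ζ hζ => extendFrom_eq (subset_closure hζ) (hin ζ hζ)
  have hclos : circle ⊆ closure disk := by
    rw [closure_disk]
    exact Metric.sphere_subset_closedBall
  refine ⟨extendFrom disk (generalSolution u₁ u₄ a₁ a₂), ⟨?_, ?_, fun ζ hζ => ?_,
    fun ζ hζ => ?_⟩, heq⟩
  · refine continuousOn_extendFrom Set.Subset.rfl fun ζ hζ => ?_
    by_cases hd : ζ ∈ disk
    · exact ⟨_, hin ζ hd⟩
    · have hc : ζ ∈ circle := by
        rw [← frontier_disk]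
        exact ⟨hζ, fun h => hd (interior_subset h)⟩
      obtain ⟨L, -, -, hL⟩ := hbd ζ hc
      exact ⟨L, hL⟩
  · exact (monogenicOn_generalSolution hu₁.continuous hu₄.continuous a₁ a₂).congr heq
  · rw [frontier_disk] at hζ
    obtain ⟨L, h1, -, hL⟩ := hbd ζ hζ
    rw [extendFrom_eq (hclos hζ) hL, h1]
  · rw [frontier_disk] at hζ
    obtain ⟨L, -, h4, hL⟩ := hbd ζ hζ
    rw [extendFrom_eq (hclos hζ) hL, h4]

/-- By density of the disk in its closure, continuity forces the two functions to agree on the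
circle as well. -/
theorem IsSolution14.congr {Φ Ψ : plane → Biharm} (h : IsSolution14 disk u₁ u₄ Φ)
    (hΨ : ContinuousOn Ψ (closure disk)) (heq : ∀ ζ ∈ disk, Ψ ζ = Φ ζ) :
    IsSolution14 disk u₁ u₄ Ψ := by
  have heq' : Set.EqOn Ψ Φ (closure disk) :=
    Set.EqOn.of_subset_closure heq hΨ h.continuousOn subset_closure Set.Subset.rfl
  exact ⟨hΨ, h.monogenicOn.congr heq,
    fun ζ hζ => by rw [heq' (frontier_subset_closure hζ), h.boundary₁ ζ hζ],
    fun ζ hζ => by rw [heq' (frontier_subset_closure hζ), h.boundary₄ ζ hζ]⟩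

theorem IsSolution14.exists_eq_generalSolution (hu₁ : DiniCondition u₁) (hu₄ : DiniCondition u₄)
    {Φ : plane → Biharm} (h : IsSolution14 disk u₁ u₄ Φ) :
    ∃ a₁ a₂ : ℝ, ∀ ζ ∈ disk, Φ ζ = generalSolution u₁ u₄ a₁ a₂ ζ := by
  obtain ⟨Φ₀, hΦ₀, heq⟩ := exists_isSolution14 hu₁ hu₄ 0 0
  have hdiff := h.sub hΦ₀
  simp only [sub_self] at hdiff
  obtain ⟨c, d, hcd⟩ := hdiff.exists_eq_const
  -- The free constants enter the scalar part as `(a₁ + a₂) i` and the nilpotent part as `-a₂ i`;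
  -- these must equal `c i` and `d i`.
  refine ⟨c + d, -d, fun ζ hζ => ?_⟩
  obtain ⟨z, rfl⟩ := planeEquiv.surjective ζ
  have hz := planeEquiv_mem_disk.1 hζ
  have hz' := mem_ball_zero_iff.1 hz
  obtain ⟨h1, h2⟩ := hcd z hz
  rw [heq _ hζ, map_sub, sub_eq_iff_eq_add] at h1 h2
  refine ext_parts ?_ ?_
  · rw [h1, scalarPart_generalSolution hu₁.continuous hu₄.continuous _ _ hz',
      scalarPart_generalSolution hu₁.continuous hu₄.continuous _ _ hz']
    push_cast
    ring
  · rw [h2, nilPart_generalSolution hu₄.continuous _ _ hz',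
      nilPart_generalSolution hu₄.continuous _ _ hz']
    push_cast
    ring

end

end Biharm

end

/-- For Dini-continuous data, a function is a solution of the (1-4)-problem in the unit disk if and
only if it is continuous on the closed disk and given in the open disk by the explicit formula with
some real `a₁`, `a₂`; and every choice of `a₁`, `a₂` does give a solution, i.e. the explicit
function extends from the open disk to a solution on the closed disk. -/
theorem theorem4 (u₁ u₄ : Biharm.plane → ℝ)
    (hu₁ : Biharm.DiniCondition u₁) (hu₄ : Biharm.DiniCondition u₄) :
    (∀ a₁ a₂ : ℝ, ∃ Φ : Biharm.plane → Biharm,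
      Biharm.IsSolution14 Biharm.disk u₁ u₄ Φ ∧
        ∀ ζ ∈ Biharm.disk, Φ ζ = Biharm.generalSolution u₁ u₄ a₁ a₂ ζ) ∧
    (∀ Φ : Biharm.plane → Biharm,
      Biharm.IsSolution14 Biharm.disk u₁ u₄ Φ ↔
        ContinuousOn Φ (closure Biharm.disk) ∧
          ∃ a₁ a₂ : ℝ, ∀ ζ ∈ Biharm.disk, Φ ζ = Biharm.generalSolution u₁ u₄ a₁ a₂ ζ) := by
  
  have key : ∀ a₁ a₂ : ℝ, ∃ Φ : Biharm.plane → Biharm,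
      Biharm.IsSolution14 Biharm.disk u₁ u₄ Φ ∧
        ∀ ζ ∈ Biharm.disk, Φ ζ = Biharm.generalSolution u₁ u₄ a₁ a₂ ζ :=
    fun a₁ a₂ => Biharm.exists_isSolution14 hu₁ hu₄ a₁ a₂
  refine ⟨key, fun Φ => ⟨fun h => ⟨h.continuousOn, h.exists_eq_generalSolution hu₁ hu₄⟩, ?_⟩⟩
  rintro ⟨hc, a₁, a₂, heq⟩
  obtain ⟨Ψ, hΨ, hΨeq⟩ := key a₁ a₂
  exact hΨ.congr hc fun ζ hζ => by rw [heq ζ hζ, hΨeq ζ hζ]
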